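/- **Setting.** Consider the Minotaur hybrid PoW/PoS protocol in the lock-step synchronous model (whatever an honest party creates or receives in a slot is known to all honest parties in the next slot), run in epochs of $R$ slots. Its parameters are the active-slots coefficient $f\in(0,1)$, the weight $\omega\in[0,1]$ of work, the fork limit $k$, the expected PoW block rate, the confirmation depth and the recency parameter. * *Leader election.* In each slot, independently over slots and parties, a party with relative virtual stake $\alpha$ is elected with probability $1-(1-f)^{\alpha}$ and may then append a main-chain block. * *Virtual stake.* In epochs $1,2$ the virtual stake is the initial stake distribution. In an epoch $e\ge 3$ a party with share $s$ of the actual stake and share $w$ of the total difficulty of the PoW blocks referenced by the chain in epoch $e-2$ has relative virtual stake $(1-\omega)s+\omega w$ (just $s$ if no PoW block was referenced). * *PoW.* Every active miner makes one hash query per slot, with the mining target of the epoch; this target is adjusted in every epoch to the referenced difficulty. * *Chain selection* (maxvalid-mc). An honest party holds the longest chains among those in its view that fork from its current chain by at most $k$ blocks. * *Bounded adversary.* The adversary is $(\theta,m,\omega)$-bounded if $\omega\beta_w^W+(1-\omega)\beta_s^W\le\theta$ for every window $W$ of at most $m$ slots, where $\beta_w^W,\beta_s^W$ are the maximal adversarial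 fractions of mining power and of stake in $W$. It decides on its actions in a slot without knowing the random values of that or later slots. * *Common prefix* with parameter $\ell$: whenever honest parties hold chains $C_1,C_2$ at slots $r_1\le r_2$, the chain $C_1$ without its blocks with timestamps in the last $\ell$ slots (that is, in $r_1-\ell+1,\dots,r_1$) is a prefix of $C_2$. **Proposition.** There is an absolute constant $c>0$ such that for every $f\in(0,1)$ there is $\ell_0$ with the following property. Let $\ell_{\rm cp}\ge\ell_0$ and $0\le\delta\le 1/\sqrt{\ell_{\rm cp}}$, and consider the protocol with this $f$, with any $k\ge\ell_{\rm cp}$ and $R\ge 2\ell_{\rm cp}$, and with any admissible values of the other parameters. 1. For every $m$ there are an environment and a $(1/2-\delta,m,\omega)$-bounded adversary such that, with probability at least $c$, common prefix with parameter $\ell_{\rm cp}$ is violated within the first epoch. The other standing assumptions can be met as well, for any prescribed $\gamma\ge1$, $\alpha_0\in(0,1]$ and $\varepsilon\in(0,1)$: the initial adversarial stake fraction is at most $1/2-\delta$; the numbers $h_r$ of honest and $n_r$ of all miners in slot $r$ change by at most a factor $\gamma$ within any $2R$ consecutive slots; $h_r\ge\alpha_0n_r$ for all $r$; and the estimate $\tilde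 h_1$ of $h_1$ satisfies $h_1/((1+\varepsilon)\gamma^2)\le\tilde h_1\le\gamma^2h_1/((1-\varepsilon)\alpha_0)$. 2. More generally, take any epoch and any distribution of stake and mining power, and suppose that at the start of the epoch all honest parties agree on one chain (every other chain known to all of them being strictly shorter), according to which the adversary's relative virtual stake for this epoch lies in $[1/2-\delta,1/2]$. Then there is an adversarial strategy from this point on that violates common prefix with parameter $\ell_{\rm cp}$ within this epoch with probability at least $c$. In particular, $\delta^2\ell_{\rm cp}$ has to exceed a positive constant if common prefix is to hold except with small probability. -/

import Mathlib

namespace Minotaur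

noncomputable section

/-- Protocol parameters: active-slots coefficient `f` of the main-chain lottery, weight `ω` of
work, expected PoW block rate `fw`, epoch length `R`, fork limit `k` (in blocks) of the chain
selection rule `maxvalid-mc`, confirmation depth `κ` (in slots), recency parameter `slRe`. -/
structure Params where
  f : ℝ
  ω : ℝ
  fw : ℝ
  R : ℕ
  k : ℕ
  κ : ℕ
  slRe : ℕ
  f_pos : 0 < f
  f_lt_one : f < 1
  ω_nonneg : 0 ≤ ω
  ω_le_one : ω ≤ 1
  fw_pos : 0 < fw
  κ_lt_R : κ < R

/-- Who takes part: the corrupted parties, the actual stake of every party, the honest and the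
corrupted miners that are active in every slot (one hash query each), and the estimate `hEst` of
the initial honest mining power that is stored in the genesis block.  Slots are `1, 2, 3, …`. -/
structure Setup (P : Type) [Fintype P] where
  corrupt : Finset P
  stake : P → ℝ
  stake_nonneg : ∀ i, 0 ≤ stake i
  stake_pos : 0 < ∑ i, stake i
  honestMiners : ℕ → Finset P
  corruptMiners : ℕ → Finset P
  honestMiners_honest : ∀ r, Disjoint (honestMiners r) corrupt
  corruptMiners_corrupt : ∀ r, corruptMiners r ⊆ corrupt
  miners_pos : ∀ r, 0 < (honestMiners r).card + (corruptMiners r).card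
  hEst : ℝ
  hEst_pos : 0 < hEst

/-! ### Adversarial resources -/

section Resources

variable {P : Type} [Fintype P]

/-- Number `h_r` of honest PoW queries in slot `r`. -/
def Setup.h (S : Setup P) (r : ℕ) : ℝ := (S.honestMiners r).card

/-- Number `n_r` of all PoW queries in slot `r`. -/
def Setup.n (S : Setup P) (r : ℕ) : ℝ := (S.honestMiners r).card + (S.corruptMiners r).card

/-- The adversarial fraction of actual stake. No stake transfers are issued, so this is the
fraction in every view at every slot. -/
def Setup.betaS (S : Setup P) : ℝ := (∑ i ∈ S.corrupt, S.stake i) / ∑ i, S.stake i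

/-- The maximal adversarial fraction of mining power in the slots of the window `[a, b]`. -/
def Setup.betaW (S : Setup P) (a b : ℕ) (hab : a ≤ b) : ℝ :=
  (Finset.Icc a b).sup' (Finset.nonempty_Icc.mpr hab) (fun r => 1 - S.h r / S.n r)

/-- The adversary is `(θ, m, ω)`-bounded: `ω β_w^W + (1 - ω) β_s^W ≤ θ` for every time window
`W` of at most `m` slots. -/
def Setup.Bounded (S : Setup P) (θ : ℝ) (m : ℕ) (ω : ℝ) : Prop :=
  ∀ (a b : ℕ) (hab : a ≤ b), 1 ≤ a → b + 1 ≤ a + m →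
    ω * S.betaW a b hab + (1 - ω) * S.betaS ≤ θ

/-- A sequence (indexed by the slots) is `(γ, s)`-respecting. -/
def Respecting (γ : ℝ) (s : ℕ) (x : ℕ → ℝ) : Prop :=
  ∀ r r' : ℕ, 1 ≤ r → 1 ≤ r' → r < r' + s → r' < r + s → x r ≤ γ * x r'

/-- The other assumptions on initialization and execution: initial stake, estimate of the initial
mining power, fluctuation of the mining power, participation of honest miners. -/
structure Setup.Standing (S : Setup P) (R : ℕ) (σ γ α₀ ε : ℝ) : Prop where
  init_stake : S.betaS ≤ 1 / 2 - σ
  init_work_lower : S.h 1 / ((1 + ε) * γ ^ 2) ≤ S.hEst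
  init_work_upper : S.hEst ≤ γ ^ 2 * S.h 1 / ((1 - ε) * α₀)
  respecting_h : Respecting γ (2 * R) S.h
  respecting_n : Respecting γ (2 * R) S.n
  participation : ∀ r, 1 ≤ r → α₀ * S.n r ≤ S.h r

end Resources

/-! ### Blocks and chains -/

/-- A main-chain (PoS) block. The PoW blocks that it references are given by their positions in
the table of all PoW blocks. The link to the parent is given by the position in a chain. -/
structure Block (P : Type) where
  slot : ℕ
  issuer : P
  pows : List ℕ

/-- A chain, oldest block first; the genesis block is left implicit, so `[]` is the chain that
consists of the genesis block. -/
abbrev Chain (P : Type) := List (Block P)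

/-- A PoW (endorser) block: its miner, its claimed slot, the main chain that ends in the confirmed
block it refers to, and the target for which it was mined. -/
structure PowBlock (P : Type) where
  miner : P
  slot : ℕ
  ref : Chain P
  target : ℝ

/-- Timestamp of the head of a chain. -/
def headSlot {P : Type} (C : Chain P) : ℕ := (C.getLast?.map Block.slot).getD 0

/-- At slot `r`, remove the blocks with timestamps in the last `ℓ` slots `r - ℓ + 1, …, r`. -/
def prune {P : Type} (ℓ r : ℕ) (C : Chain P) : Chain P :=
  C.takeWhile (fun b => decide (b.slot + ℓ ≤ r))

/-- The epoch `e` of slot `r`: epoch `e` consists of the slots `(e - 1) R + 1, …, e R`. -/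
def epoch (R r : ℕ) : ℕ := (r - 1) / R + 1

/-- The PoW blocks from the table `W` that are referenced by blocks of `C` with timestamps in
`(a, b]`. -/
def powsIn {P : Type} (W : List (PowBlock P)) (C : Chain P) (a b : ℕ) : List (PowBlock P) :=
  (C.filter (fun B => decide (a < B.slot ∧ B.slot ≤ b))).flatMap
    (fun B => B.pows.filterMap (fun i => W[i]?))

/-- Total difficulty of a list of PoW blocks. -/
def difficulty {P : Type} (L : List (PowBlock P)) : ℝ := (L.map (fun w => 1 / w.target)).sum

section Protocol

variable {P : Type} [Fintype P]

/-- The mining target of an epoch according to the chain `C`. Hash values are scaled to `[0, 1]`.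
In epoch 1 the target comes from the genesis block; later it is `fw` times the number of slots
in `((e - 2) R - κ, (e - 1) R - κ]` divided by the total difficulty of the PoW blocks referenced
there. It is left unchanged should there be no such PoW block. -/
def target (Q : Params) (S : Setup P) (W : List (PowBlock P)) (C : Chain P) : ℕ → ℝ
  | 0 => Q.fw / S.hEst
  | 1 => Q.fw / S.hEst
  | e + 2 =>
      let a := e * Q.R - Q.κ
      let b := (e + 1) * Q.R - Q.κ
      let D := difficulty (powsIn W C a b)
      if D = 0 then target Q S W C (e + 1) else Q.fw * ((b - a : ℕ) : ℝ) / D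

/-- Share of party `i` in the actual stake. -/
def stakeShare (S : Setup P) (i : P) : ℝ := S.stake i / ∑ j, S.stake j

open Classical in
/-- Share of party `i` in the difficulty of the PoW blocks referenced by `C` in epoch `e`. -/
def workShare (Q : Params) (W : List (PowBlock P)) (C : Chain P) (e : ℕ) (i : P) : ℝ :=
  let L := powsIn W C ((e - 1) * Q.R) (e * Q.R)
  difficulty (L.filter (fun w => decide (w.miner = i))) / difficulty L

/-- Relative virtual stake of party `i` in epoch `e` according to the chain `C`: the initial stake
in epochs 1 and 2, and from then on the combination, with weights `1 - ω` and `ω`, of actual stake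
and of the work stake earned in epoch `e - 2`. (If no PoW block was referenced there is no
work stake, and only the actual stake counts.) -/
def virtualStake (Q : Params) (S : Setup P) (W : List (PowBlock P)) (C : Chain P) (e : ℕ)
    (i : P) : ℝ :=
  if e ≤ 2 ∨ difficulty (powsIn W C ((e - 3) * Q.R) ((e - 2) * Q.R)) = 0 then stakeShare S i
  else (1 - Q.ω) * stakeShare S i + Q.ω * workShare Q W C (e - 2) i

/-- Virtual stake of all corrupted parties together. -/
def advVirtualStake (Q : Params) (S : Setup P) (W : List (PowBlock P)) (C : Chain P) (e : ℕ) :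
    ℝ :=
  ∑ i ∈ S.corrupt, virtualStake Q S W C e i

/-- The probability `φ_f(α) = 1 - (1 - f) ^ α` to be elected with relative virtual stake `α`. -/
def phi (f α : ℝ) : ℝ := 1 - (1 - f) ^ α

end Protocol

/-! ### Randomness -/

/-- The random values of an execution: for every slot and party, one value for the main-chain
lottery (`false`) and one for the hash query of the party (`true`). -/
abbrev Coins (P : Type) := ℕ × P × Bool → unitInterval

/-- All random values are independent and uniform on `[0, 1]`. -/
def coinLaw (P : Type) : MeasureTheory.Measure (Coins P) :=
  MeasureTheory.Measure.infinitePi (fun _ => MeasureTheory.volume)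

section Execution

variable {P : Type} [Fintype P]

/-- With the chain `C` as parent, party `i` is elected to issue a block in slot `r`. -/
def Elected (Q : Params) (S : Setup P) (x : Coins P) (W : List (PowBlock P)) (C : Chain P)
    (r : ℕ) (i : P) : Prop :=
  (x (r, i, false) : ℝ) < phi Q.f (virtualStake Q S W C (epoch Q.R r) i)

/-- The PoW block number `j` of the table `W` may be referenced by a block of slot `r` that
extends `C`: it refers to a confirmed block that lies on `C`, is older than its claimed slot and is recent,
it was mined for the right target, and it is not yet referenced. -/
def PowOK (Q : Params) (S : Setup P) (W : List (PowBlock P)) (C : Chain P) (r j : ℕ) : Prop :=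
  ∃ w, W[j]? = some w ∧ headSlot w.ref < w.slot ∧ w.slot < r ∧ w.ref <+: C ∧
    r ≤ headSlot w.ref + Q.slRe ∧
    w.target = target Q S W C (epoch Q.R w.slot) ∧ ∀ B ∈ C, j ∉ B.pows

/-- The state after some slot. -/
structure State (P : Type) where
  /-- all chains that exist -/
  chains : Set (Chain P)
  /-- the chains known to all honest parties -/
  pub : Set (Chain P)
  /-- the table of all PoW blocks found so far; it only grows at its end -/
  pows : List (PowBlock P)
  /-- (positions of) the PoW blocks known to all honest parties -/
  pubPows : Set ℕ
  /-- the chain adopted by each honest party -/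
  cur : P → Chain P

/-- The state before slot 1. -/
def genesis (P : Type) : State P where
  chains := {[]}
  pub := {[]}
  pows := []
  pubPows := ∅
  cur := fun _ => []

/-- What the adversary does in a slot: for every honest party, the chains delivered to it right
away; the PoW blocks that are released; the blocks that it tries to append to existing
chains, as triples (parent chain, issuer, referenced PoW blocks); for every corrupted miner, the
claimed slot and the chain that ends in the confirmed block its hash query refers to. -/
structure Action (P : Type) where
  deliver : P → Set (Chain P)
  release : Set ℕ
  propose : Set (Chain P × P × List ℕ)
  query : P → ℕ × Chain P

/-- The adversary acts in slot `r` on the basis of the state after slot `r - 1`. In particular it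
does not know the random values of the current and of later slots. -/
abbrev Adversary (P : Type) := ℕ → State P → Action P

/-- The chains in the view of the honest party `i` in a slot. -/
def view (st : State P) (a : Action P) (i : P) : Set (Chain P) :=
  st.pub ∪ (a.deliver i ∩ st.chains)

/-- `C'` forks from `C` by at most `k` blocks: at most `k` blocks of `C` would be discarded. -/
def ForksAtMost (k : ℕ) (C C' : Chain P) : Prop :=
  ∃ D : Chain P, D <+: C ∧ D <+: C' ∧ C.length ≤ D.length + k

/-- The chains held by the honest party `i`, i.e. the best chains in its view according to
`maxvalid-mc`: the longest ones among those that fork by at most `k` blocks from its current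
chain. -/
def held (Q : Params) (st : State P) (a : Action P) (i : P) : Set (Chain P) :=
  {C | C ∈ view st a i ∧ ForksAtMost Q.k (st.cur i) C ∧
    ∀ C' ∈ view st a i, ForksAtMost Q.k (st.cur i) C' → C'.length ≤ C.length}

open Classical in
/-- The chain adopted by the honest party `i`: the current one if it is among the best chains,
otherwise one of the best chains. -/
def adopt (Q : Params) (st : State P) (a : Action P) (i : P) : Chain P :=
  if st.cur i ∈ held Q st a i then st.cur i
  else if h : (held Q st a i).Nonempty then h.some else st.cur i

open Classical in
/-- An honest party that is elected in slot `r` extends its chain `C` by this block, which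
references all PoW blocks that it knows and that may be referenced. -/
def honestBlock (Q : Params) (S : Setup P) (st : State P) (r : ℕ) (C : Chain P) (i : P) :
    Block P where
  slot := r
  issuer := i
  pows := (List.range st.pows.length).filter
    (fun j => decide (j ∈ st.pubPows ∧ PowOK Q S st.pows C r j))

open Classical in
/-- The chain of the honest party `i` at the end of slot `r`. -/
def honestChain (Q : Params) (S : Setup P) (x : Coins P) (st : State P) (r : ℕ) (a : Action P)
    (i : P) : Chain P :=
  let C := adopt Q st a i
  if Elected Q S x st.pows C r i then C ++ [honestBlock Q S st r C i] else C

/-- The chains that the adversary creates in slot `r`: a corrupted party that is elected for the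
parent chain appends a valid block. It may do so for several parent chains. -/
def advChains (Q : Params) (S : Setup P) (x : Coins P) (st : State P) (r : ℕ) (a : Action P) :
    Set (Chain P) :=
  {C' | ∃ C i L, (C, i, L) ∈ a.propose ∧ C ∈ st.chains ∧ i ∈ S.corrupt ∧ headSlot C < r ∧
    Elected Q S x st.pows C r i ∧ L.Nodup ∧ (∀ j ∈ L, PowOK Q S st.pows C r j) ∧
    C' = C ++ [⟨r, i, L⟩]}

/-- The PoW block that the query of party `i` in slot `r` is about. Honest miners refer to the
last confirmed block of their chain. -/
def powCandidate (Q : Params) (S : Setup P) (st : State P) (r : ℕ) (a : Action P) (i : P) :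
    PowBlock P :=
  open Classical in
  let s := if i ∈ S.corrupt then (a.query i).1 else r
  let C := if i ∈ S.corrupt then (a.query i).2 else prune Q.κ r (adopt Q st a i)
  ⟨i, s, C, target Q S st.pows C (epoch Q.R s)⟩

open Classical in
/-- The PoW blocks found in slot `r`. Every active miner makes one query, and is successful if
the hash value is below the target. -/
def newPows (Q : Params) (S : Setup P) (x : Coins P) (st : State P) (r : ℕ) (a : Action P) :
    List (PowBlock P) :=
  ((Finset.univ : Finset P).toList.filter (fun i =>
      decide (i ∈ S.honestMiners r ∪ S.corruptMiners r ∧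
        (x (r, i, true) : ℝ) < (powCandidate Q S st r a i).target))).map
    (powCandidate Q S st r a)

/-- One slot of the execution, in the lock-step synchronous model: what an honest party creates
or receives in a slot is known to all honest parties in the next slot. -/
def step (Q : Params) (S : Setup P) (x : Coins P) (st : State P) (r : ℕ) (a : Action P) :
    State P :=
  let honestNew := {C | ∃ i, i ∉ S.corrupt ∧ C = honestChain Q S x st r a i}
  let delivered := {C | ∃ i, i ∉ S.corrupt ∧ C ∈ view st a i}
  let W := st.pows ++ newPows Q S x st r a
  { chains := st.chains ∪ honestNew ∪ advChains Q S x st r a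
    pub := st.pub ∪ honestNew ∪ delivered
    pows := W
    pubPows := st.pubPows ∪ {j | j < st.pows.length ∧ j ∈ a.release} ∪
      {j | st.pows.length ≤ j ∧ ∃ w, W[j]? = some w ∧ w.miner ∉ S.corrupt}
    cur := honestChain Q S x st r a }

/-- The state after `n` slots, from the state `st₀` after slot `t₀`. -/
def run (Q : Params) (S : Setup P) (A : Adversary P) (t₀ : ℕ) (st₀ : State P) (x : Coins P) :
    ℕ → State P
  | 0 => st₀
  | n + 1 =>
      let st := run Q S A t₀ st₀ x n
      step Q S x st (t₀ + n + 1) (A (t₀ + n + 1) st)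

/-- `C` is held by the honest party `i` at slot `t₀ + n + 1` in the execution from `st₀`. -/
def HeldAt (Q : Params) (S : Setup P) (A : Adversary P) (t₀ : ℕ) (st₀ : State P) (x : Coins P)
    (n : ℕ) (i : P) (C : Chain P) : Prop :=
  i ∉ S.corrupt ∧
    C ∈ held Q (run Q S A t₀ st₀ x n) (A (t₀ + n + 1) (run Q S A t₀ st₀ x n)) i

/-- Common prefix with parameter `ℓ` in the `T` slots `t₀ + 1, …, t₀ + T`: whenever honest parties
hold `C₁`, `C₂` at slots `r₁ ≤ r₂`, then `C₁` pruned by the last `ℓ` slots is a prefix of `C₂`. -/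
def CommonPrefix (Q : Params) (S : Setup P) (A : Adversary P) (t₀ : ℕ) (st₀ : State P)
    (x : Coins P) (ℓ T : ℕ) : Prop :=
  ∀ n₁ n₂ : ℕ, n₁ ≤ n₂ → n₂ < T → ∀ (i j : P) (C₁ C₂ : Chain P),
    HeldAt Q S A t₀ st₀ x n₁ i C₁ → HeldAt Q S A t₀ st₀ x n₂ j C₂ →
      prune ℓ (t₀ + n₁ + 1) C₁ <+: C₂

/-- `st` is a state after slot `t` in which all honest parties agree on the chain `C₀`; the
adversary may have withheld any other chains and PoW blocks. -/
structure Agreement (S : Setup P) (t : ℕ) (st : State P) (C₀ : Chain P) : Prop where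
  cur_eq : ∀ i, i ∉ S.corrupt → st.cur i = C₀
  chains_finite : st.chains.Finite
  mem_chains : C₀ ∈ st.chains
  mem_pub : C₀ ∈ st.pub
  pub_chains : st.pub ⊆ st.chains
  pub_shorter : ∀ C ∈ st.pub, C ≠ C₀ → C.length < C₀.length
  slots_sorted : ∀ C ∈ st.chains, C.Pairwise (fun B B' => B.slot < B'.slot)
  slots_pos : ∀ C ∈ st.chains, ∀ B ∈ C, 1 ≤ B.slot
  slots_le : ∀ C ∈ st.chains, ∀ B ∈ C, B.slot ≤ t
  pows_lt : ∀ C ∈ st.chains, ∀ B ∈ C, ∀ j ∈ B.pows, j < st.pows.length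
  target_pos : ∀ w ∈ st.pows, 0 < w.target

/-- The probability that the adversary violates common prefix with parameter `ℓ` within `T` slots,
when the execution continues from the state `st₀` after slot `t₀` with fresh randomness. -/
def cpFailure (Q : Params) (S : Setup P) (A : Adversary P) (t₀ : ℕ) (st₀ : State P) (ℓ T : ℕ) :
    ENNReal :=
  coinLaw P {x | ¬ CommonPrefix Q S A t₀ st₀ x ℓ T}

end Execution

end

end Minotaur

/-!
From the start `t` of the epoch on, the adversary mines a private chain on top of the common chain
`C₀` and shows nothing to the honest parties. As nobody forks, both sides add exactly one block in
each slot in which one of their parties is elected, and the election probabilities are fixed by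
`C₀`: the PoW blocks that matter for the virtual stake of this epoch are referenced in `C₀`. In
slot `t + ℓ + s + 1` the adversary delivers a private chain of the same length as the honest ones.
If the honest chains have a block with timestamp at most `t + s + 1`, which pruning does not
remove, and at most `ℓ ≤ k` blocks in total, so that `maxvalid-mc` accepts the fork, then common
prefix is violated.

If both sides had virtual stake `1 / 2`, exchanging them would show that the private chain is long
enough with probability at least `1 / 2`; the other two conditions fail with probability at most
`1 / 8` each, for suitable `s` and large `ℓ`, so the attack works with probability at least
`1 / 4`. For virtual stake `α` in place of `1 / 2`, one slot has likelihood ratio with second moment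
at most `exp (32 (α - 1 / 2) ^ 2)`. This holds uniformly in `f`, which is what makes the constant
absolute. Over the `2 (ℓ + s) ≤ 4 ℓ` independent coordinates the second moment remains bounded by
`exp 128` if `(α - 1 / 2) ^ 2 ≤ 1 / ℓ`, and by Cauchy–Schwarz the attack still has probability at
least `(1 / 4) ^ 2 / exp 128`.
-/

namespace Minotaur

open Finset MeasureTheory ProbabilityTheory

section ChangeOfMeasure

variable {Ω : Type*} [Fintype Ω] [MeasurableSpace Ω]

/-- The second moment `∫ (dμ/dν)² dν` of the likelihood ratio of two measures on a finite space.
It is meaningful only if `ν` charges every point: a term with `ν {a} = 0` counts as `0`. -/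
noncomputable def likelihoodSecondMoment (μ ν : Measure Ω) : ℝ :=
  ∑ a, μ.real {a} ^ 2 / ν.real {a}

lemma likelihoodSecondMoment_nonneg (μ ν : Measure Ω) : 0 ≤ likelihoodSecondMoment μ ν :=
  sum_nonneg fun _ _ => by positivity

lemma sq_measureReal_le_mul_likelihoodSecondMoment [MeasurableSingletonClass Ω] {μ ν : Measure Ω}
    [IsFiniteMeasure μ] [IsFiniteMeasure ν] (hν : ∀ a, 0 < ν.real {a}) (E : Set Ω) :
    μ.real E ^ 2 ≤ ν.real E * likelihoodSecondMoment μ ν := by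
  classical
  obtain ⟨E, rfl⟩ : ∃ F : Finset Ω, (F : Set Ω) = E := E.toFinite.exists_finset_coe
  simp only [← sum_measureReal_singleton]
  rcases E.eq_empty_or_nonempty with rfl | hE
  · simp
  have cauchy_schwarz := sq_sum_div_le_sum_sq_div E (fun a => μ.real {a}) fun a _ => hν a
  rw [div_le_iff₀' (sum_pos (fun a _ => hν a) hE)] at cauchy_schwarz
  refine cauchy_schwarz.trans (mul_le_mul_of_nonneg_left ?_ (sum_nonneg fun a _ => (hν a).le))
  exact sum_le_univ_sum_of_nonneg fun a => by positivity

lemma likelihoodSecondMoment_pi {ι : Type*} [Fintype ι] [DecidableEq ι] (μ ν : ι → Measure Ω)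
    [∀ i, SigmaFinite (μ i)] [∀ i, SigmaFinite (ν i)] :
    likelihoodSecondMoment (Measure.pi μ) (Measure.pi ν) =
      ∏ i, likelihoodSecondMoment (μ i) (ν i) := by
  simp only [likelihoodSecondMoment, Fintype.prod_sum, prod_div_distrib, prod_pow,
    measureReal_def, Measure.pi_singleton, ENNReal.toReal_prod]

end ChangeOfMeasure

lemma half_le_measureReal_of_exchange {Ω : Type*} [MeasurableSpace Ω] {μ : Measure Ω}
    [IsProbabilityMeasure μ] {σ : Ω → Ω} (hσ : MeasurePreserving σ μ μ) {X Y : Ω → ℕ}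
    (hX : Measurable X) (hY : Measurable Y) (hXσ : ∀ ω, X (σ ω) = Y ω)
    (hYσ : ∀ ω, Y (σ ω) = X ω) : 1 / 2 ≤ μ.real {ω | X ω ≤ Y ω} := by
  have hXY : MeasurableSet {ω | X ω ≤ Y ω} := measurableSet_le hX hY
  have hswap : μ.real {ω | Y ω ≤ X ω} = μ.real {ω | X ω ≤ Y ω} := by
    rw [← hσ.measureReal_preimage hXY.nullMeasurableSet]
    simp only [Set.preimage_ofPred_eq, hXσ, hYσ]
  have hcover : 1 ≤ μ.real {ω | X ω ≤ Y ω} + μ.real {ω | Y ω ≤ X ω} := by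
    rw [← probReal_univ (μ := μ)]
    refine (measureReal_mono fun ω _ => ?_).trans (measureReal_union_le _ _)
    exact le_total (X ω) (Y ω)
  linarith

section Patterns

variable {ι : Type*} [Fintype ι] (μ : Measure Bool) [IsProbabilityMeasure μ]

lemma measureReal_singleton_true : μ.real {true} = 1 - μ.real {false} := by
  rw [← probReal_compl_eq_one_sub (MeasurableSet.singleton false)]
  congr 1
  ext b
  cases b <;> simp

lemma pi_real_forall_eq_false (T : Finset ι) :
    (Measure.pi fun _ : ι => μ).real {ω | ∀ i ∈ T, ω i = false} = μ.real {false} ^ #T := by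
  have h := Measure.infinitePi_pi (fun _ : ι => μ) (s := T) (t := fun _ => {false})
    fun _ _ => MeasurableSet.singleton false
  rw [Measure.infinitePi_eq_pi, prod_const] at h
  rw [measureReal_def, measureReal_def, ← ENNReal.toReal_pow, ← h]
  rfl

lemma pi_real_card_false_le_le (T : Finset ι) (s : ℕ) :
    (Measure.pi fun _ : ι => μ).real {ω | #{i ∈ T | ω i = false} ≤ s} ≤
      2 ^ s * (1 - μ.real {false} / 2) ^ #T := by
  classical
  set halving : ι → Bool → ℝ := fun i b => if i ∈ T ∧ b = false then 1 / 2 else 1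
  have hprod (ω : ι → Bool) : ∏ i, halving i (ω i) = (1 / 2) ^ #{i ∈ T | ω i = false} := by
    simp only [halving, prod_ite, prod_const, one_pow, mul_one]
    congr 2
    ext i
    simp
  have hmean : ∫ ω, ∏ i, halving i (ω i) ∂(Measure.pi fun _ => μ) =
      (1 - μ.real {false} / 2) ^ #T := by
    rw [integral_fintype_prod_eq_prod]
    have (i : ι) : ∫ b, halving i b ∂μ = if i ∈ T then 1 - μ.real {false} / 2 else 1 := by
      rw [integral_fintype .of_finite]
      simp only [halving, Fintype.sum_bool, measureReal_singleton_true]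
      by_cases hi : i ∈ T
      · simp [hi]
        ring
      · simp [hi]
    simp [this]
  have markov := mul_meas_ge_le_integral_of_nonneg
    (μ := Measure.pi fun _ : ι => μ) (f := fun ω => ∏ i, halving i (ω i))
    (.of_forall fun ω => by simp only [hprod]; positivity) .of_finite ((1 / 2) ^ s)
  rw [hmean, one_div, inv_pow, inv_mul_le_iff₀ (by positivity)] at markov
  refine (measureReal_mono fun ω hω => ?_).trans markov
  simp only [Set.mem_ofPred_eq, hprod, one_div, ← inv_pow] at hω ⊢
  exact pow_le_pow_of_le_one (by norm_num) (by norm_num) hω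

end Patterns

section AttackPatterns

/-- The number of slots with a hit on one side. A pattern records for each of `N` slots whether
the honest parties (side `true`) and the corrupted parties (side `false`) have a hit, i.e. whether
some party of that side is elected. -/
def hits {N : ℕ} (ω : Fin N × Bool → Bool) (side : Bool) : ℕ := #{n | ω (n, side) = true}

/-- The patterns that break common prefix: the corrupted side has at least as many hits as the
honest one, which has a hit among the first `s + 1` slots, and at most `ℓ` hits altogether. -/
def attackPatterns (N s ℓ : ℕ) : Set (Fin N × Bool → Bool) :=
  {ω | hits ω true ≤ hits ω false ∧ (∃ n : Fin N, n.1 ≤ s ∧ ω (n, true) = true) ∧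
    hits ω true ≤ ℓ}

variable (μ : Measure Bool) [IsProbabilityMeasure μ]

lemma half_le_pi_real_hits_le_hits (N : ℕ) :
    1 / 2 ≤ (Measure.pi fun _ : Fin N × Bool => μ).real {ω | hits ω true ≤ hits ω false} := by
  have exchange_sides := measurePreserving_arrowCongr' (fun _ : Fin N × Bool => μ) (fun _ => μ)
    ((Equiv.refl (Fin N)).prodCongr Equiv.boolNot) (MeasurableEquiv.refl Bool) fun _ => .id μ
  exact half_le_measureReal_of_exchange exchange_sides (X := (hits · true)) (Y := (hits · false))
    .of_discrete .of_discrete (fun _ => rfl) fun _ => rfl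

lemma pi_real_no_early_hit {N s : ℕ} (hs : s < N) :
    (Measure.pi fun _ : Fin N × Bool => μ).real
      {ω | ¬ ∃ n : Fin N, n.1 ≤ s ∧ ω (n, true) = true} = μ.real {false} ^ (s + 1) := by
  have hcard : #((Iic (⟨s, hs⟩ : Fin N)) ×ˢ {true}) = s + 1 := by simp
  rw [← hcard, ← pi_real_forall_eq_false]
  congr 1
  ext ω
  simp [Fin.le_def]

lemma pi_real_lt_hits_le (ℓ s : ℕ) :
    (Measure.pi fun _ : Fin (ℓ + s) × Bool => μ).real {ω | ℓ < hits ω true} ≤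
      2 ^ s * (1 - μ.real {false} / 2) ^ ℓ := by
  have hfalse_nonneg : 0 ≤ μ.real {false} := measureReal_nonneg
  have hfalse_le_one : μ.real {false} ≤ 1 := measureReal_le_one
  have few_misses := pi_real_card_false_le_le μ ((univ : Finset (Fin (ℓ + s))) ×ˢ {true}) s
  rw [card_product, card_univ, Fintype.card_fin, card_singleton, mul_one] at few_misses
  refine (measureReal_mono fun ω hω => ?_).trans (few_misses.trans ?_)
  · have hmisses : #{p ∈ (univ : Finset (Fin (ℓ + s))) ×ˢ {true} | ω p = false} =
        #{n | ¬ ω (n, true) = true} := by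
      rw [product_singleton, filter_map, card_map]
      simp
    have hsum := card_filter_add_card_filter_not (s := univ)
      fun n : Fin (ℓ + s) => ω (n, true) = true
    simp only [hits, Set.mem_ofPred_eq, hmisses, card_univ, Fintype.card_fin] at hω hsum ⊢
    omega
  · gcongr ?_ * ?_
    exact pow_le_pow_of_le_one (by linarith) (by linarith) (by omega)

lemma quarter_le_pi_real_attackPatterns {ℓ s : ℕ} (hℓ : 0 < ℓ)
    (hs : μ.real {false} ^ (s + 1) ≤ 1 / 8)
    (hℓs : 2 ^ s * (1 - μ.real {false} / 2) ^ ℓ ≤ 1 / 8) :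
    1 / 4 ≤ (Measure.pi fun _ : Fin (ℓ + s) × Bool => μ).real (attackPatterns (ℓ + s) s ℓ) := by
  have enough_corrupted_hits := half_le_pi_real_hits_le_hits μ (ℓ + s)
  have no_early_hit := pi_real_no_early_hit μ (show s < ℓ + s by omega)
  have many_hits := pi_real_lt_hits_le μ ℓ s
  have hcover : {ω : Fin (ℓ + s) × Bool → Bool | hits ω true ≤ hits ω false} ⊆
      attackPatterns (ℓ + s) s ℓ ∪
        {ω | ¬ ∃ n : Fin (ℓ + s), n.1 ≤ s ∧ ω (n, true) = true} ∪ {ω | ℓ < hits ω true} := by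
    intro ω hω
    by_cases hearly : ∃ n : Fin (ℓ + s), n.1 ≤ s ∧ ω (n, true) = true
    · exact (le_or_gt (hits ω true) ℓ).imp (fun hfew => .inl ⟨hω, hearly, hfew⟩) id
    · exact .inl (.inr hearly)
  have hunion := (measureReal_mono (μ := Measure.pi fun _ => μ) hcover).trans <|
    (measureReal_union_le _ _).trans (add_le_add_left (measureReal_union_le _ _) _)
  linarith

end AttackPatterns

section ElectionProbability

lemma sq_log_mul_rpow_quarter_le {g : ℝ} (hg : 0 < g) (hg' : g ≤ 1) :
    Real.log g ^ 2 * g ^ (1 / 4 : ℝ) ≤ 32 * (1 - g ^ (1 / 4 : ℝ)) := by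
  obtain ⟨v, hv, rfl⟩ : ∃ v : ℝ, 0 ≤ v ∧ Real.exp (-(4 * v)) = g :=
    ⟨-Real.log g / 4, by linarith [Real.log_nonpos hg.le hg'], by
      rw [mul_div_cancel₀ _ four_ne_zero, neg_neg, Real.exp_log hg]⟩
  rw [Real.log_exp, ← Real.exp_mul, show -(4 * v) * (1 / 4) = -v by ring]
  have hexp : Real.exp v * Real.exp (-v) = 1 := by rw [← Real.exp_add]; simp
  nlinarith [mul_le_mul_of_nonneg_right (Real.quadratic_le_exp_of_nonneg hv) (Real.exp_nonneg (-v)),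
    mul_nonneg hv (Real.exp_nonneg (-v))]

lemma sq_rpow_sub_rpow_le {g : ℝ} (hg : 0 < g) (a b : ℝ) :
    (g ^ a - g ^ b) ^ 2 ≤ Real.log g ^ 2 * (a - b) ^ 2 * max (g ^ a) (g ^ b) ^ 2 := by
  wlog hab : g ^ b ≤ g ^ a generalizing a b
  · have := this b a (le_of_not_ge hab)
    rwa [max_comm, sub_sq_comm, sub_sq_comm a b]
  rw [max_eq_left hab]
  have hfactor : g ^ a - g ^ b = g ^ a * (1 - Real.exp (Real.log g * (b - a))) := by
    rw [← Real.rpow_def_of_pos hg, mul_sub, ← Real.rpow_add hg, mul_one, add_sub_cancel]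
  have htangent := Real.add_one_le_exp (Real.log g * (b - a))
  have hle : g ^ a - g ^ b ≤ g ^ a * (Real.log g * (a - b)) := by
    rw [hfactor]
    gcongr
    linarith
  calc (g ^ a - g ^ b) ^ 2 ≤ (g ^ a * (Real.log g * (a - b))) ^ 2 := by
        gcongr
    _ = _ := by ring

lemma sq_rpow_half_sub_rpow_le {g α : ℝ} (hg : 0 < g) (hg' : g ≤ 1)
    (hα : |α - 1 / 2| ≤ 1 / 4) :
    (g ^ (1 / 2 : ℝ) - g ^ α) ^ 2 ≤ 32 * (α - 1 / 2) ^ 2 * (g ^ α * (1 - g ^ α)) := by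
  obtain ⟨hα_lower, hα_upper⟩ := abs_le.mp hα
  have hquarter : g ^ α ≤ g ^ (1 / 4 : ℝ) :=
    Real.rpow_le_rpow_of_exponent_ge hg hg' (by linarith)
  have hmax : max (g ^ (1 / 2 : ℝ)) (g ^ α) ^ 2 ≤ g ^ α * g ^ (1 / 4 : ℝ) := by
    rcases max_choice (g ^ (1 / 2 : ℝ)) (g ^ α) with h | h <;>
      rw [h, sq, ← Real.rpow_add hg, ← Real.rpow_add hg] <;>
      exact Real.rpow_le_rpow_of_exponent_ge hg hg' (by linarith)
  calc (g ^ (1 / 2 : ℝ) - g ^ α) ^ 2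
      ≤ Real.log g ^ 2 * (1 / 2 - α) ^ 2 * (g ^ α * g ^ (1 / 4 : ℝ)) :=
        (sq_rpow_sub_rpow_le hg _ _).trans (by gcongr)
    _ = (α - 1 / 2) ^ 2 * g ^ α * (Real.log g ^ 2 * g ^ (1 / 4 : ℝ)) := by ring
    _ ≤ (α - 1 / 2) ^ 2 * g ^ α * (32 * (1 - g ^ α)) := by
        refine mul_le_mul_of_nonneg_left ?_ (by positivity)
        linarith [sq_log_mul_rpow_quarter_le hg hg']
    _ = 32 * (α - 1 / 2) ^ 2 * (g ^ α * (1 - g ^ α)) := by ring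

lemma likelihoodSecondMoment_le_exp {g α : ℝ} (hg : 0 < g) (hg' : g < 1)
    (hα : |α - 1 / 2| ≤ 1 / 4) {μ ν : Measure Bool} [IsProbabilityMeasure μ]
    [IsProbabilityMeasure ν] (hμ : μ.real {false} = g ^ (1 / 2 : ℝ))
    (hν : ν.real {false} = g ^ α) :
    likelihoodSecondMoment μ ν ≤ Real.exp (32 * (α - 1 / 2) ^ 2) := by
  have hα_pos : 0 < α := by linarith [(abs_le.mp hα).1]
  have hlt : 0 < 1 - g ^ α := sub_pos.mpr (Real.rpow_lt_one hg.le hg' hα_pos)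
  calc likelihoodSecondMoment μ ν
      = (1 - g ^ (1 / 2 : ℝ)) ^ 2 / (1 - g ^ α) + (g ^ (1 / 2 : ℝ)) ^ 2 / g ^ α := by
        simp only [likelihoodSecondMoment, Fintype.sum_bool, measureReal_singleton_true, hμ, hν]
    _ = (g ^ (1 / 2 : ℝ) - g ^ α) ^ 2 / (g ^ α * (1 - g ^ α)) + 1 := by
        field_simp
        ring
    _ ≤ 32 * (α - 1 / 2) ^ 2 + 1 := by
        gcongr
        exact div_le_of_le_mul₀ (by positivity) (by positivity)
          (sq_rpow_half_sub_rpow_le hg hg'.le hα)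
    _ ≤ Real.exp (32 * (α - 1 / 2) ^ 2) := Real.add_one_le_exp _

end ElectionProbability

section AttackBound

lemma sq_pi_real_le_exp_mul_pi_real {g d : ℝ} (hg : 0 < g) (hg' : g < 1) (hd : d ≤ 1 / 4)
    {ι : Type*} [Fintype ι] {α : ι → ℝ} (hα : ∀ i, |α i - 1 / 2| ≤ d) {μ : Measure Bool}
    [IsProbabilityMeasure μ] (hμ : μ.real {false} = g ^ (1 / 2 : ℝ)) {ν : ι → Measure Bool}
    [∀ i, IsProbabilityMeasure (ν i)] (hν : ∀ i, (ν i).real {false} = g ^ α i)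
    (E : Set (ι → Bool)) :
    (Measure.pi fun _ => μ).real E ^ 2 ≤
      Real.exp (32 * d ^ 2 * Fintype.card ι) * (Measure.pi ν).real E := by
  classical
  have hpoint (i : ι) (b : Bool) : 0 < (ν i).real {b} := by
    have hα_pos : 0 < α i := by linarith [(abs_le.mp (hα i)).1]
    cases b
    · rw [hν]
      positivity
    · rw [measureReal_singleton_true, hν]
      exact sub_pos.mpr (Real.rpow_lt_one hg.le hg' hα_pos)
  refine (sq_measureReal_le_mul_likelihoodSecondMoment (ν := Measure.pi ν) (fun ω => ?_) E).trans ?_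
  · rw [measureReal_def, Measure.pi_singleton, ENNReal.toReal_prod]
    exact prod_pos fun i _ => hpoint i (ω i)
  rw [mul_comm, likelihoodSecondMoment_pi]
  gcongr
  calc ∏ i, likelihoodSecondMoment μ (ν i)
      ≤ ∏ _i : ι, Real.exp (32 * d ^ 2) := by
        gcongr with i
        · exact fun i _ => likelihoodSecondMoment_nonneg _ _
        · refine (likelihoodSecondMoment_le_exp hg hg' ((hα i).trans hd) hμ (hν i)).trans ?_
          rw [← sq_abs (α i - 1 / 2)]
          gcongr
          exact hα i
    _ = Real.exp (32 * d ^ 2 * Fintype.card ι) := by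
        rw [prod_const, card_univ, ← Real.exp_nat_mul, mul_comm]

lemma exists_pow_succ_le_and_two_pow_mul_pow_le {q : ℝ} (hq : 0 < q) (hq' : q < 1) {ε : ℝ}
    (hε : 0 < ε) :
    ∃ s ℓ₀ : ℕ, q ^ (s + 1) ≤ ε ∧ ∀ ℓ ≥ ℓ₀, 2 ^ s * (1 - q / 2) ^ ℓ ≤ ε := by
  obtain ⟨s, hs⟩ := exists_pow_lt_of_lt_one hε hq'
  have htendsto : Filter.Tendsto (fun ℓ : ℕ => 2 ^ s * (1 - q / 2) ^ ℓ) .atTop (nhds 0) := by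
    simpa using (tendsto_pow_atTop_nhds_zero_of_lt_one (r := 1 - q / 2) (by linarith)
      (by linarith)).const_mul (2 ^ s)
  obtain ⟨ℓ₀, hℓ₀⟩ := Filter.eventually_atTop.mp (htendsto.eventually_le_const hε)
  exact ⟨s, ℓ₀, (pow_le_pow_of_le_one hq.le hq'.le s.le_succ).trans hs.le, hℓ₀⟩

lemma exists_attackPatterns_bound {g : ℝ} (hg : 0 < g) (hg' : g < 1) :
    ∃ ℓ₀ s : ℕ, 16 ≤ ℓ₀ ∧ s < ℓ₀ ∧ ∀ ℓ ≥ ℓ₀, ∀ α : Bool → ℝ,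
      (∀ b, |α b - 1 / 2| ≤ 1 / √ℓ) → ∀ (ν : Fin (ℓ + s) × Bool → Measure Bool)
      [∀ p, IsProbabilityMeasure (ν p)], (∀ p, (ν p).real {false} = g ^ α p.2) →
        Real.exp (-128) / 16 ≤ (Measure.pi ν).real (attackPatterns (ℓ + s) s ℓ) := by
  have hq : 0 < g ^ (1 / 2 : ℝ) := by positivity
  have hq' : g ^ (1 / 2 : ℝ) < 1 := Real.rpow_lt_one hg.le hg' (by norm_num)
  obtain ⟨s, ℓ₁, hearly, hmany⟩ :=
    exists_pow_succ_le_and_two_pow_mul_pow_le hq hq' (show (0 : ℝ) < 1 / 8 by norm_num)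
  refine ⟨max 16 (max (s + 1) ℓ₁), s, by simp, by simp, fun ℓ hℓ α hα ν _ hν => ?_⟩
  simp only [ge_iff_le, max_le_iff] at hℓ
  obtain ⟨h16, hs, hℓ₁⟩ := hℓ
  set μ : Measure Bool := bernoulliMeasure false true ⟨g ^ (1 / 2 : ℝ), hq.le, hq'.le⟩
  have hμ : μ.real {false} = g ^ (1 / 2 : ℝ) := by simp [μ]
  have quarter := quarter_le_pi_real_attackPatterns μ (ℓ := ℓ) (s := s) (by omega)
    (by rwa [hμ]) (by rw [hμ]; exact hmany ℓ hℓ₁)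
  have hd : 1 / √ℓ ≤ 1 / 4 :=
    one_div_le_one_div_of_le four_pos (Real.le_sqrt_of_sq_le (by norm_num; exact_mod_cast h16))
  have transfer := sq_pi_real_le_exp_mul_pi_real hg hg' hd
    (fun p : Fin (ℓ + s) × Bool => hα p.2) hμ hν (attackPatterns (ℓ + s) s ℓ)
  have hexponent : 32 * (1 / √ℓ) ^ 2 * Fintype.card (Fin (ℓ + s) × Bool) ≤ 128 := by
    have hℓ_pos : (0 : ℝ) < ℓ := by exact_mod_cast show 0 < ℓ by omega
    have hs' : (s : ℝ) ≤ ℓ := by exact_mod_cast (Nat.lt_of_succ_le hs).le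
    rw [div_pow, Real.sq_sqrt hℓ_pos.le]
    simp only [Fintype.card_prod, Fintype.card_fin, Fintype.card_bool]
    push_cast
    rw [one_pow, mul_one_div, div_mul_eq_mul_div, div_le_iff₀ hℓ_pos]
    linarith
  have hsixteenth : 1 / 16 ≤ (Measure.pi fun _ => μ).real (attackPatterns (ℓ + s) s ℓ) ^ 2 := by
    nlinarith
  rw [Real.exp_neg, div_eq_mul_one_div, inv_mul_le_iff₀ (Real.exp_pos _)]
  refine hsixteenth.trans (transfer.trans ?_)
  gcongr

end AttackBound

section Lottery

lemma iIndepSet_pi_infinitePi {κ ι : Type*} {X : ι → Type*} [∀ i, MeasurableSpace (X i)]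
    (μ : ∀ i, Measure (X i)) [∀ i, IsProbabilityMeasure (μ i)] {I : κ → Finset ι}
    (hI : Pairwise (Function.onFun Disjoint I)) {A : ∀ i, Set (X i)}
    (hA : ∀ i, MeasurableSet (A i)) :
    iIndepSet (fun k => (I k : Set ι).pi A) (Measure.infinitePi μ) := by
  classical
  rw [iIndepSet_iff_meas_biInter fun k => .pi (I k).countable_toSet fun i _ => hA i]
  intro s
  have hunion : ⋂ k ∈ s, (I k : Set ι).pi A = ((s.biUnion I : Finset ι) : Set ι).pi A := by
    ext x
    simp only [Set.mem_iInter, Set.mem_pi, mem_coe, mem_biUnion]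
    grind
  simp only [hunion, Measure.infinitePi_pi μ fun i _ => hA i]
  exact prod_biUnion (hI.set_pairwise _)

variable {P : Type}

instance : IsProbabilityMeasure (coinLaw P) := by
  unfold coinLaw
  infer_instance

/-- Some party in `D` is elected in slot `r`, where `τ i` is the probability that party `i` is. -/
def Hit (τ : P → ℝ) (D : Finset P) (x : Coins P) (r : ℕ) : Prop :=
  ∃ i ∈ D, (x (r, i, false) : ℝ) < τ i

open Classical in
/-- The pattern of hits in the `N` slots after slot `t`, where `D true` and `D false` are the
honest and the corrupted parties. -/
noncomputable def hitPattern (τ : P → ℝ) (D : Bool → Finset P) (t N : ℕ) (x : Coins P) :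
    Fin N × Bool → Bool :=
  fun p => decide (Hit τ (D p.2) x (t + p.1 + 1))

/-- The lottery coins of the parties in `D` in slot `r`. -/
def lotteryCoins (D : Finset P) (r : ℕ) : Finset (ℕ × P × Bool) :=
  D.map ⟨fun i => (r, i, false), fun i j h => by simpa using h⟩

lemma mem_lotteryCoins {D : Finset P} {r : ℕ} {z : ℕ × P × Bool} :
    z ∈ lotteryCoins D r ↔ ∃ i ∈ D, (r, i, false) = z :=
  mem_map

lemma setOf_not_hit (τ : P → ℝ) (D : Finset P) (r : ℕ) :
    {x : Coins P | ¬ Hit τ D x r} = (lotteryCoins D r : Set (ℕ × P × Bool)).pi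
      fun z => {u : unitInterval | τ z.2.1 ≤ u} := by
  ext x
  simp [Hit, mem_lotteryCoins]

lemma measurableSet_setOf_le (τ : ℝ) : MeasurableSet {u : unitInterval | τ ≤ u} :=
  measurableSet_le measurable_const measurable_subtype_coe

lemma measurableSet_not_hit (τ : P → ℝ) (D : Finset P) (r : ℕ) :
    MeasurableSet {x : Coins P | ¬ Hit τ D x r} := by
  rw [setOf_not_hit]
  exact .pi (lotteryCoins D r).countable_toSet fun _ _ => measurableSet_setOf_le _

lemma coinLaw_real_not_hit {τ : P → ℝ} (h0 : ∀ i, 0 ≤ τ i) (h1 : ∀ i, τ i ≤ 1) (D : Finset P)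
    (r : ℕ) : (coinLaw P).real {x | ¬ Hit τ D x r} = ∏ i ∈ D, (1 - τ i) := by
  have hvolume (i : P) : volume {u : unitInterval | τ i ≤ u} = ENNReal.ofReal (1 - τ i) :=
    unitInterval.volume_Ici ⟨τ i, h0 i, h1 i⟩
  rw [setOf_not_hit, measureReal_def, coinLaw,
    Measure.infinitePi_pi _ fun _ _ => measurableSet_setOf_le _, lotteryCoins, prod_map,
    ENNReal.toReal_prod]
  refine prod_congr rfl fun i _ => ?_
  simp only [hvolume]
  exact ENNReal.toReal_ofReal (sub_nonneg.mpr (h1 i))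

lemma pairwise_disjoint_lotteryCoins {D : Bool → Finset P} (hD : Disjoint (D true) (D false))
    (t N : ℕ) :
    Pairwise (Function.onFun Disjoint
      fun p : Fin N × Bool => lotteryCoins (D p.2) (t + p.1 + 1)) := by
  rintro ⟨n, b⟩ ⟨n', b'⟩ hne
  refine disjoint_left.mpr fun z hz hz' => hne ?_
  obtain ⟨i, hi, rfl⟩ := mem_lotteryCoins.mp hz
  obtain ⟨j, hj, hji⟩ := mem_lotteryCoins.mp hz'
  simp only [Prod.mk.injEq, and_true] at hji
  obtain ⟨hn, rfl⟩ := hji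
  have hb : b = b' := by
    cases b <;> cases b' <;> simp_all [disjoint_left]
  exact Prod.ext (Fin.ext (by simp only; omega)) hb

lemma measurable_hitPattern_apply (τ : P → ℝ) (D : Bool → Finset P) (t : ℕ) {N : ℕ}
    (p : Fin N × Bool) : Measurable fun x => hitPattern τ D t N x p := by
  refine measurable_to_bool ?_
  convert! (measurableSet_not_hit τ (D p.2) (t + p.1 + 1)).compl using 1
  ext x
  simp [hitPattern]

lemma iIndepFun_hitPattern (τ : P → ℝ) {D : Bool → Finset P} (hD : Disjoint (D true) (D false))
    (t N : ℕ) :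
    iIndepFun (fun (p : Fin N × Bool) x => hitPattern τ D t N x p) (coinLaw P) := by
  have hmisses := iIndepSet_pi_infinitePi (fun _ : ℕ × P × Bool => (volume : Measure unitInterval))
    (pairwise_disjoint_lotteryCoins hD t N) fun z => measurableSet_setOf_le (τ z.2.1)
  simp only [← setOf_not_hit] at hmisses
  convert! (hmisses.iIndepFun_indicator (β := ℕ)).comp (fun _ m => decide (m = 0))
    fun _ => .of_discrete using 2 with p
  ext x
  simp [hitPattern]

lemma map_hitPattern_coinLaw (τ : P → ℝ) {D : Bool → Finset P}
    (hD : Disjoint (D true) (D false)) (t N : ℕ) :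
    (coinLaw P).map (hitPattern τ D t N) =
      Measure.pi fun p => (coinLaw P).map fun x => hitPattern τ D t N x p :=
  (iIndepFun_hitPattern τ hD t N).map_fun_eq_pi_map
    fun p => (measurable_hitPattern_apply τ D t p).aemeasurable

lemma map_hitPattern_apply_real_false {τ : P → ℝ} (h0 : ∀ i, 0 ≤ τ i) (h1 : ∀ i, τ i ≤ 1)
    (D : Bool → Finset P) (t : ℕ) {N : ℕ} (p : Fin N × Bool) :
    ((coinLaw P).map fun x => hitPattern τ D t N x p).real {false} =
      ∏ i ∈ D p.2, (1 - τ i) := by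
  rw [map_measureReal_apply (measurable_hitPattern_apply τ D t p) (.singleton false),
    ← coinLaw_real_not_hit h0 h1 (D p.2) (t + p.1 + 1)]
  congr 1
  ext x
  simp [hitPattern]

end Lottery

section VirtualStake

variable {P : Type}

lemma powsIn_append {W₀ W : List (PowBlock P)} {C₀ E : Chain P} {t a b : ℕ} (hW : W₀ <+: W)
    (hpows : ∀ B ∈ C₀, ∀ j ∈ B.pows, j < W₀.length) (hE : ∀ B ∈ E, t < B.slot) (hb : b ≤ t) :
    powsIn W (C₀ ++ E) a b = powsIn W₀ C₀ a b := by
  obtain ⟨W', rfl⟩ := hW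
  have hnil : E.filter (fun B => decide (a < B.slot ∧ B.slot ≤ b)) = [] := by
    refine List.filter_eq_nil_iff.mpr fun B hB => ?_
    have := hE B hB
    simp only [decide_eq_true_eq]
    omega
  rw [powsIn, List.filter_append, hnil, List.append_nil]
  exact List.flatMap_congr fun B hB => List.filterMap_congr fun j hj =>
    List.getElem?_append_left (hpows B (List.mem_of_mem_filter hB) j hj)

lemma mem_of_mem_powsIn {W : List (PowBlock P)} {C : Chain P} {a b : ℕ} {w : PowBlock P}
    (hw : w ∈ powsIn W C a b) : w ∈ W := by
  simp only [powsIn, List.mem_flatMap, List.mem_filterMap] at hw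
  obtain ⟨_, _, _, _, hj⟩ := hw
  exact List.mem_of_getElem? hj

lemma difficulty_nonneg {L : List (PowBlock P)} (hL : ∀ w ∈ L, 0 < w.target) :
    0 ≤ difficulty L := by
  refine List.sum_nonneg fun y hy => ?_
  obtain ⟨w, hw, rfl⟩ := List.mem_map.mp hy
  exact (one_div_pos.mpr (hL w hw)).le

lemma workShare_nonneg (Q : Params) {W : List (PowBlock P)} (hW : ∀ w ∈ W, 0 < w.target)
    (C : Chain P) (e : ℕ) (i : P) : 0 ≤ workShare Q W C e i :=
  div_nonneg
    (difficulty_nonneg fun w hw => hW w (mem_of_mem_powsIn (List.mem_of_mem_filter hw)))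
    (difficulty_nonneg fun w hw => hW w (mem_of_mem_powsIn hw))

variable [Fintype P]

open Classical in
lemma sum_difficulty_filter_miner (L : List (PowBlock P)) :
    ∑ i, difficulty (L.filter fun w => decide (w.miner = i)) = difficulty L := by
  induction L with
  | nil => simp [difficulty]
  | cons w L ih =>
    have hcons (i : P) : difficulty ((w :: L).filter fun w => decide (w.miner = i)) =
        (if w.miner = i then 1 / w.target else 0) +
          difficulty (L.filter fun w => decide (w.miner = i)) := by
      by_cases hi : w.miner = i <;> simp [difficulty, hi]
    simp only [hcons, sum_add_distrib, ih]
    simp [difficulty]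

lemma sum_workShare (Q : Params) {W : List (PowBlock P)} {C : Chain P} {e : ℕ}
    (h : difficulty (powsIn W C ((e - 1) * Q.R) (e * Q.R)) ≠ 0) :
    ∑ i, workShare Q W C e i = 1 := by
  simp only [workShare, ← sum_div, sum_difficulty_filter_miner]
  exact div_self h

lemma stakeShare_nonneg (S : Setup P) (i : P) : 0 ≤ stakeShare S i :=
  div_nonneg (S.stake_nonneg i) S.stake_pos.le

lemma sum_stakeShare (S : Setup P) : ∑ i, stakeShare S i = 1 := by
  simp only [stakeShare, ← sum_div]
  exact div_self S.stake_pos.ne'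

variable (Q : Params) (S : Setup P)

lemma virtualStake_nonneg {W : List (PowBlock P)} (hW : ∀ w ∈ W, 0 < w.target) (C : Chain P)
    (e : ℕ) (i : P) : 0 ≤ virtualStake Q S W C e i := by
  unfold virtualStake
  split_ifs
  · exact stakeShare_nonneg S i
  · exact add_nonneg (mul_nonneg (sub_nonneg.mpr Q.ω_le_one) (stakeShare_nonneg S i))
      (mul_nonneg Q.ω_nonneg (workShare_nonneg Q hW C _ i))

lemma sum_virtualStake (W : List (PowBlock P)) (C : Chain P) (e : ℕ) :
    ∑ i, virtualStake Q S W C e i = 1 := by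
  unfold virtualStake
  split_ifs with h
  · exact sum_stakeShare S
  · rw [sum_add_distrib, ← mul_sum, ← mul_sum, sum_stakeShare,
      sum_workShare Q (e := e - 2) (not_or.mp h).2]
    ring

lemma virtualStake_append {W₀ W : List (PowBlock P)} {C₀ E : Chain P} {e : ℕ} (hW : W₀ <+: W)
    (hpows : ∀ B ∈ C₀, ∀ j ∈ B.pows, j < W₀.length) (hE : ∀ B ∈ E, (e - 1) * Q.R < B.slot) :
    virtualStake Q S W (C₀ ++ E) e = virtualStake Q S W₀ C₀ e := by
  have he : (e - 2) * Q.R ≤ (e - 1) * Q.R := Nat.mul_le_mul_right _ (by omega)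
  funext i
  unfold virtualStake workShare
  rw [powsIn_append hW hpows hE he, powsIn_append hW hpows hE he]

/-- The probability that party `i` is elected in a slot of epoch `e` according to `C`. -/
noncomputable def electionProb (W : List (PowBlock P)) (C : Chain P) (e : ℕ) (i : P) : ℝ :=
  phi Q.f (virtualStake Q S W C e i)

lemma electionProb_nonneg {W : List (PowBlock P)} (hW : ∀ w ∈ W, 0 < w.target) (C : Chain P)
    (e : ℕ) (i : P) : 0 ≤ electionProb Q S W C e i :=
  sub_nonneg.mpr <| Real.rpow_le_one (sub_nonneg.mpr Q.f_lt_one.le)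
    (sub_le_self 1 Q.f_pos.le) (virtualStake_nonneg Q S hW C e i)

lemma electionProb_le_one (W : List (PowBlock P)) (C : Chain P) (e : ℕ) (i : P) :
    electionProb Q S W C e i ≤ 1 :=
  sub_le_self 1 (Real.rpow_nonneg (sub_nonneg.mpr Q.f_lt_one.le) _)

lemma prod_one_sub_electionProb (W : List (PowBlock P)) (C : Chain P) (e : ℕ) (D : Finset P) :
    ∏ i ∈ D, (1 - electionProb Q S W C e i) =
      (1 - Q.f) ^ ∑ i ∈ D, virtualStake Q S W C e i := by
  simp only [electionProb, phi, sub_sub_cancel]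
  exact (Real.rpow_sum_of_pos (sub_pos.mpr Q.f_lt_one) _ _).symm

lemma epoch_sub_one_mul_add {R e n : ℕ} (he : 1 ≤ e) (hn : n < R) :
    epoch R ((e - 1) * R + n + 1) = e := by
  rw [epoch, Nat.add_sub_cancel, Nat.mul_comm, Nat.mul_add_div (by omega), Nat.div_eq_of_lt hn]
  omega

variable {Q S}

lemma elected_append_iff {W₀ W : List (PowBlock P)} {C₀ E : Chain P} {e n : ℕ} (he : 1 ≤ e)
    (hn : n < Q.R) (hW : W₀ <+: W) (hpows : ∀ B ∈ C₀, ∀ j ∈ B.pows, j < W₀.length)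
    (hE : ∀ B ∈ E, (e - 1) * Q.R < B.slot) {x : Coins P} {i : P} :
    Elected Q S x W (C₀ ++ E) ((e - 1) * Q.R + n + 1) i ↔
      (x ((e - 1) * Q.R + n + 1, i, false) : ℝ) < electionProb Q S W₀ C₀ e i := by
  rw [Elected, epoch_sub_one_mul_add he hn, virtualStake_append Q S hW hpows hE, electionProb]

end VirtualStake

section HitSlots

variable {P : Type}

open Classical in
/-- The slots with a hit of `D` among the `n` slots after slot `t`, in increasing order. -/
noncomputable def hitSlots (τ : P → ℝ) (D : Finset P) (x : Coins P) (t n : ℕ) : List ℕ :=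
  (List.range' (t + 1) n).filter (Hit τ D x ·)

variable {τ : P → ℝ} {D : Finset P} {x : Coins P} {t n r : ℕ}

lemma mem_hitSlots : r ∈ hitSlots τ D x t n ↔ (t < r ∧ r ≤ t + n) ∧ Hit τ D x r := by
  simp only [hitSlots, List.mem_filter, List.mem_range'_1, decide_eq_true_eq]
  refine and_congr_left fun _ => ?_
  omega

lemma hitSlots_succ_of_hit (h : Hit τ D x (t + n + 1)) :
    hitSlots τ D x t (n + 1) = hitSlots τ D x t n ++ [t + n + 1] := by
  simp [hitSlots, List.range'_1_concat, add_right_comm t 1 n, h]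

lemma hitSlots_succ_of_not_hit (h : ¬ Hit τ D x (t + n + 1)) :
    hitSlots τ D x t (n + 1) = hitSlots τ D x t n := by
  simp [hitSlots, List.range'_1_concat, add_right_comm t 1 n, h]

lemma hitSlots_prefix {N : ℕ} (h : n ≤ N) : hitSlots τ D x t n <+: hitSlots τ D x t N := by
  obtain ⟨m, rfl⟩ := Nat.exists_eq_add_of_le h
  exact List.IsPrefix.filter _ ⟨_, List.range'_append_1⟩

lemma length_hitSlots (τ : P → ℝ) (D : Bool → Finset P) (x : Coins P) (t N : ℕ) (b : Bool) :
    (hitSlots τ (D b) x t N).length = hits (hitPattern τ D t N x) b := by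
  classical
  have hlength (n : ℕ) : (hitSlots τ (D b) x t n).length =
      ∑ m ∈ range n, if Hit τ (D b) x (t + m + 1) then 1 else 0 := by
    induction n with
    | zero => simp [hitSlots]
    | succ n ih =>
      by_cases h : Hit τ (D b) x (t + n + 1)
      · rw [sum_range_succ, if_pos h, ← ih, hitSlots_succ_of_hit h, List.length_append,
          List.length_singleton]
      · rw [sum_range_succ, if_neg h, ← ih, hitSlots_succ_of_not_hit h, add_zero]
  rw [hlength, ← Fin.sum_univ_eq_sum_range fun m => if Hit τ (D b) x (t + m + 1) then 1 else 0,
    hits, card_filter]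
  simp [hitPattern]

end HitSlots

section ProtocolSteps

variable {P : Type} {ℓ r : ℕ}

lemma prefix_prune {D C : Chain P} (hDC : D <+: C) (hD : ∀ B ∈ D, B.slot + ℓ ≤ r) :
    D <+: prune ℓ r C := by
  obtain ⟨E, rfl⟩ := hDC
  rw [prune, List.takeWhile_append_of_pos fun B hB => decide_eq_true (hD B hB)]
  exact List.prefix_append _ _

lemma headSlot_lt {C : Chain P} (hr : 0 < r) (h : ∀ B ∈ C, B.slot < r) : headSlot C < r := by
  unfold headSlot
  cases hhead : C.getLast? with
  | none => exact hr
  | some B => exact h B (List.mem_of_getLast? hhead)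

variable {Q : Params} {st : State P} {a : Action P}

lemma adopt_mem_held {i : P} (h : (held Q st a i).Nonempty) :
    adopt Q st a i ∈ held Q st a i := by
  unfold adopt
  split_ifs with hcur
  · exact hcur
  · exact h.some_mem

lemma view_eq_pub {i : P} (ha : a.deliver i = ∅) : view st a i = st.pub := by
  rw [view, ha, Set.empty_inter, Set.union_empty]

variable [Fintype P] {S : Setup P} {x : Coins P}

lemma honestChain_of_elected {i : P} (h : Elected Q S x st.pows (adopt Q st a i) r i) :
    honestChain Q S x st r a i =
      adopt Q st a i ++ [honestBlock Q S st r (adopt Q st a i) i] :=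
  if_pos h

lemma honestChain_of_not_elected {i : P} (h : ¬ Elected Q S x st.pows (adopt Q st a i) r i) :
    honestChain Q S x st r a i = adopt Q st a i :=
  if_neg h

lemma mem_pub_step (ha : ∀ i, a.deliver i = ∅) {C : Chain P} :
    C ∈ (step Q S x st r a).pub ↔
      C ∈ st.pub ∨ ∃ i, i ∉ S.corrupt ∧ C = honestChain Q S x st r a i := by
  simp only [step, Set.mem_union, Set.mem_ofPred_eq, view_eq_pub (ha _)]
  exact or_iff_left_of_imp fun ⟨_, _, hC⟩ => .inl hC

lemma chains_subset_chains_step : st.chains ⊆ (step Q S x st r a).chains :=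
  fun _ hC => .inl (.inl hC)

lemma pows_prefix_pows_run {A : Adversary P} {t n : ℕ} :
    st.pows <+: (run Q S A t st x n).pows := by
  induction n with
  | zero => exact List.prefix_rfl
  | succ n ih => exact ih.trans (List.prefix_append _ _)

end ProtocolSteps

section PublicChains

variable {P : Type} [Fintype P] {Q : Params} {S : Setup P} {C₀ C : Chain P} {H : List ℕ}

/-- `C` extends `C₀` by honest blocks, whose timestamps are listed by `H`. -/
def IsHonestExtension (S : Setup P) (C₀ : Chain P) (H : List ℕ) (C : Chain P) : Prop :=
  ∃ E : Chain P, C = C₀ ++ E ∧ (∀ B ∈ E, B.issuer ∉ S.corrupt) ∧ E.map Block.slot = H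

lemma IsHonestExtension.refl (S : Setup P) (C : Chain P) : IsHonestExtension S C [] C :=
  ⟨[], by simp⟩

lemma IsHonestExtension.isPrefix (h : IsHonestExtension S C₀ H C) : C₀ <+: C := by
  obtain ⟨E, rfl, -⟩ := h
  exact List.prefix_append _ _

lemma IsHonestExtension.length_eq (h : IsHonestExtension S C₀ H C) :
    C.length = C₀.length + H.length := by
  obtain ⟨E, rfl, -, rfl⟩ := h
  simp

lemma IsHonestExtension.append_block (h : IsHonestExtension S C₀ H C) {B : Block P}
    (hB : B.issuer ∉ S.corrupt) : IsHonestExtension S C₀ (H ++ [B.slot]) (C ++ [B]) := by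
  obtain ⟨E, rfl, honest, rfl⟩ := h
  refine ⟨E ++ [B], List.append_assoc .., fun B' hB' => ?_, by simp⟩
  rcases List.mem_append.mp hB' with hB' | hB'
  · exact honest B' hB'
  · exact List.mem_singleton.mp hB' ▸ hB

/-- The situation of the honest parties while the adversary delivers nothing: the longest chains
that all of them know are the extensions of `C₀` by honest blocks in the slots `H`. -/
structure PublicInvariant (S : Setup P) (C₀ : Chain P) (H : List ℕ) (st : State P) : Prop where
  extension_or_shorter :
    ∀ C ∈ st.pub, IsHonestExtension S C₀ H C ∨ C.length < C₀.length + H.length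
  exists_extension : ∃ C ∈ st.pub, IsHonestExtension S C₀ H C
  cur_prefix : ∀ i ∉ S.corrupt, C₀ <+: st.cur i
  cur_length_le : ∀ i ∉ S.corrupt, (st.cur i).length ≤ C₀.length + H.length

namespace PublicInvariant

variable {st : State P} {a : Action P} {r : ℕ} {x : Coins P} {i : P}

lemma length_le (h : PublicInvariant S C₀ H st) (hC : C ∈ st.pub) :
    C.length ≤ C₀.length + H.length :=
  (h.extension_or_shorter C hC).elim (·.length_eq.le) le_of_lt

lemma mem_held (h : PublicInvariant S C₀ H st) (hk : H.length ≤ Q.k) (hi : i ∉ S.corrupt)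
    (hview : ∀ C' ∈ view st a i, C'.length ≤ C₀.length + H.length) (hC : C ∈ view st a i)
    (hprefix : C₀ <+: C) (hlength : C.length = C₀.length + H.length) : C ∈ held Q st a i := by
  have hcur := h.cur_length_le i hi
  exact ⟨hC, ⟨C₀, h.cur_prefix i hi, hprefix, by omega⟩,
    fun C' hC' _ => hlength ▸ hview C' hC'⟩

lemma isHonestExtension_adopt (h : PublicInvariant S C₀ H st) (hk : H.length ≤ Q.k)
    (ha : a.deliver i = ∅) (hi : i ∉ S.corrupt) :
    IsHonestExtension S C₀ H (adopt Q st a i) := by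
  obtain ⟨C, hC, hext⟩ := h.exists_extension
  have hheld : C ∈ held Q st a i :=
    h.mem_held hk hi (fun C' hC' => h.length_le (view_eq_pub ha ▸ hC')) (.inl hC) hext.isPrefix
      hext.length_eq
  obtain ⟨hview, -, hlongest⟩ := adopt_mem_held ⟨C, hheld⟩
  have hle := hlongest C hheld.1 hheld.2.1
  rw [hext.length_eq] at hle
  exact (h.extension_or_shorter _ (view_eq_pub ha ▸ hview)).resolve_right hle.not_gt

lemma isHonestExtension_honestChain_of_elected (h : PublicInvariant S C₀ H st)
    (hk : H.length ≤ Q.k) (ha : a.deliver i = ∅) (hi : i ∉ S.corrupt)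
    (hel : Elected Q S x st.pows (adopt Q st a i) r i) :
    IsHonestExtension S C₀ (H ++ [r]) (honestChain Q S x st r a i) := by
  rw [honestChain_of_elected hel]
  exact (h.isHonestExtension_adopt hk ha hi).append_block
    (B := honestBlock Q S st r (adopt Q st a i) i) hi

lemma isHonestExtension_honestChain_of_not_elected (h : PublicInvariant S C₀ H st)
    (hk : H.length ≤ Q.k) (ha : a.deliver i = ∅) (hi : i ∉ S.corrupt)
    (hel : ¬ Elected Q S x st.pows (adopt Q st a i) r i) :
    IsHonestExtension S C₀ H (honestChain Q S x st r a i) := by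
  rw [honestChain_of_not_elected hel]
  exact h.isHonestExtension_adopt hk ha hi

lemma step_of_not_elected (h : PublicInvariant S C₀ H st) (hk : H.length ≤ Q.k)
    (ha : ∀ i, a.deliver i = ∅)
    (hel : ∀ i ∉ S.corrupt, ¬ Elected Q S x st.pows (adopt Q st a i) r i) :
    PublicInvariant S C₀ H (step Q S x st r a) := by
  have hext (i : P) (hi : i ∉ S.corrupt) :=
    h.isHonestExtension_honestChain_of_not_elected hk (ha i) hi (hel i hi)
  refine ⟨fun C hC => ?_, ?_, fun i hi => (hext i hi).isPrefix,
    fun i hi => (hext i hi).length_eq.le⟩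
  · rcases (mem_pub_step ha).mp hC with hC | ⟨i, hi, rfl⟩
    · exact h.extension_or_shorter C hC
    · exact .inl (hext i hi)
  · obtain ⟨C, hC, hCext⟩ := h.exists_extension
    exact ⟨C, (mem_pub_step ha).mpr (.inl hC), hCext⟩

lemma step_of_elected (h : PublicInvariant S C₀ H st) (hk : H.length ≤ Q.k)
    (ha : ∀ i, a.deliver i = ∅) (hi : i ∉ S.corrupt)
    (hel : Elected Q S x st.pows (adopt Q st a i) r i) :
    PublicInvariant S C₀ (H ++ [r]) (step Q S x st r a) := by
  have hlength : (H ++ [r]).length = H.length + 1 := by simp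
  have hext (j : P) (hj : j ∉ S.corrupt) :
      IsHonestExtension S C₀ (H ++ [r]) (honestChain Q S x st r a j) ∨
        IsHonestExtension S C₀ H (honestChain Q S x st r a j) :=
    (em (Elected Q S x st.pows (adopt Q st a j) r j)).imp
      (h.isHonestExtension_honestChain_of_elected hk (ha j) hj)
      (h.isHonestExtension_honestChain_of_not_elected hk (ha j) hj)
  refine ⟨fun C hC => ?_,
    ⟨honestChain Q S x st r a i, (mem_pub_step ha).mpr (.inr ⟨i, hi, rfl⟩),
      h.isHonestExtension_honestChain_of_elected hk (ha i) hi hel⟩,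
    fun j hj => (hext j hj).elim (·.isPrefix) (·.isPrefix), fun j hj => ?_⟩
  · rcases (mem_pub_step ha).mp hC with hC | ⟨j, hj, rfl⟩
    · have := h.length_le hC
      exact .inr (by omega)
    · refine (hext j hj).imp_right fun hold => ?_
      have := hold.length_eq
      omega
  · change (honestChain Q S x st r a j).length ≤ _
    rcases hext j hj with hj | hj <;> have := hj.length_eq <;> omega

end PublicInvariant

end PublicChains

section PrivateChains

variable {P : Type} [Fintype P] {Q : Params} {S : Setup P} {C₀ C : Chain P} {t r N : ℕ}

/-- `C` extends `C₀` by corrupted blocks with timestamps after slot `t` and before slot `r`. -/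
def IsPrivate (S : Setup P) (t r : ℕ) (C₀ C : Chain P) : Prop :=
  ∃ E : Chain P, C = C₀ ++ E ∧ ∀ B ∈ E, B.issuer ∈ S.corrupt ∧ t < B.slot ∧ B.slot < r

lemma IsPrivate.refl (S : Setup P) (t r : ℕ) (C : Chain P) : IsPrivate S t r C C :=
  ⟨[], by simp⟩

lemma IsPrivate.isPrefix (h : IsPrivate S t r C₀ C) : C₀ <+: C := by
  obtain ⟨E, rfl, -⟩ := h
  exact List.prefix_append _ _

lemma IsPrivate.mono {r' : ℕ} (h : IsPrivate S t r C₀ C) (hr : r ≤ r') :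
    IsPrivate S t r' C₀ C := by
  obtain ⟨E, rfl, hE⟩ := h
  exact ⟨E, rfl, fun B hB => ⟨(hE B hB).1, (hE B hB).2.1, (hE B hB).2.2.trans_le hr⟩⟩

lemma IsPrivate.append_block (h : IsPrivate S t r C₀ C) (ht : t < r) {B : Block P}
    (hB : B.issuer ∈ S.corrupt) (hr : B.slot = r) : IsPrivate S t (r + 1) C₀ (C ++ [B]) := by
  obtain ⟨E, rfl, hE⟩ := h.mono r.le_succ
  refine ⟨E ++ [B], List.append_assoc .., fun B' hB' => ?_⟩
  rcases List.mem_append.mp hB' with hB' | hB'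
  · exact hE B' hB'
  · rw [List.mem_singleton.mp hB']
    exact ⟨hB, by omega, by omega⟩

lemma IsPrivate.headSlot_lt (h : IsPrivate S t r C₀ C) (ht : t < r)
    (hC₀ : ∀ B ∈ C₀, B.slot ≤ t) : headSlot C < r := by
  obtain ⟨E, rfl, hE⟩ := h
  refine Minotaur.headSlot_lt (by omega) fun B hB => ?_
  rcases List.mem_append.mp hB with hB | hB
  · exact (hC₀ B hB).trans_lt ht
  · exact (hE B hB).2.2

/-- The strategy of the adversary that extends `C₀` in private. In slot `t + N + 1` it delivers its
private chains, but only those not longer than some public chain: the honest parties shall not be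
driven off the public chain, but have a choice between two longest chains. -/
def privateAttack (S : Setup P) (t N : ℕ) (C₀ : Chain P) : Adversary P := fun r st =>
  { deliver := fun _ =>
      {C | r = t + N + 1 ∧ IsPrivate S t r C₀ C ∧ ∃ C' ∈ st.pub, C.length ≤ C'.length}
    release := ∅
    propose := {p | IsPrivate S t r C₀ p.1 ∧ p.2.2 = []}
    query := fun _ => (0, []) }

lemma privateAttack_deliver_of_ne (hr : r ≠ t + N + 1) (st : State P) (i : P) :
    (privateAttack S t N C₀ r st).deliver i = ∅ :=
  Set.eq_empty_of_forall_notMem fun _ hC => hr hC.1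

lemma PublicInvariant.length_le_of_mem_view_privateAttack {H : List ℕ} {st : State P}
    (h : PublicInvariant S C₀ H st) {i : P} (hC : C ∈ view st (privateAttack S t N C₀ r st) i) :
    C.length ≤ C₀.length + H.length := by
  rcases hC with hC | ⟨⟨-, -, C', hC', hle⟩, -⟩
  · exact h.length_le hC
  · exact hle.trans (h.length_le hC')

lemma IsPrivate.append_block_mem_chains_step {x : Coins P} {st : State P} {i : P}
    (h : IsPrivate S t r C₀ C) (ht : t < r) (hC₀ : ∀ B ∈ C₀, B.slot ≤ t) (hC : C ∈ st.chains)
    (hi : i ∈ S.corrupt) (hel : Elected Q S x st.pows C r i) :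
    C ++ [⟨r, i, []⟩] ∈ (step Q S x st r (privateAttack S t N C₀ r st)).chains :=
  .inr ⟨C, i, [], ⟨h, rfl⟩, hC, hi, h.headSlot_lt ht hC₀, hel, List.nodup_nil, by simp, rfl⟩

end PrivateChains

section Attack

variable {P : Type} [Fintype P] {Q : Params} {S : Setup P} {st₀ : State P} {C₀ : Chain P}
  {x : Coins P} {e n N : ℕ}

open Classical in
/-- The honest (`true`) and the corrupted (`false`) parties. -/
noncomputable def Setup.side (S : Setup P) (b : Bool) : Finset P :=
  if b then S.corruptᶜ else S.corrupt

lemma Setup.mem_side_true {i : P} : i ∈ S.side true ↔ i ∉ S.corrupt := by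
  simp [Setup.side]

lemma Setup.disjoint_side (S : Setup P) : Disjoint (S.side true) (S.side false) :=
  disjoint_left.mpr fun _ htrue hfalse => mem_side_true.mp htrue hfalse

/-- The slots in which an honest (`b = true`) or a corrupted (`b = false`) party is elected, among
the first `n` slots of epoch `e`. -/
noncomputable def electionSlots (Q : Params) (S : Setup P) (st₀ : State P) (C₀ : Chain P) (e : ℕ)
    (x : Coins P) (b : Bool) (n : ℕ) : List ℕ :=
  hitSlots (electionProb Q S st₀.pows C₀ e) (S.side b) x ((e - 1) * Q.R) n

lemma publicInvariant_of_agreement {t : ℕ} (h : Agreement S t st₀ C₀) :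
    PublicInvariant S C₀ [] st₀ where
  extension_or_shorter C hC := by
    by_cases hne : C = C₀
    · exact .inl (hne ▸ .refl S C)
    · exact .inr (h.pub_shorter C hC hne)
  exists_extension := ⟨C₀, h.mem_pub, .refl S C₀⟩
  cur_prefix i hi := by rw [h.cur_eq i hi]
  cur_length_le i hi := by rw [h.cur_eq i hi, List.length_nil, add_zero]

lemma IsHonestExtension.elected_iff {W : List (PowBlock P)} {C : Chain P} {i : P} (he : 1 ≤ e)
    (hn : n < Q.R) (hA : Agreement S ((e - 1) * Q.R) st₀ C₀) (hW : st₀.pows <+: W)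
    (h : IsHonestExtension S C₀ (electionSlots Q S st₀ C₀ e x true n) C) :
    Elected Q S x W C ((e - 1) * Q.R + n + 1) i ↔
      (x ((e - 1) * Q.R + n + 1, i, false) : ℝ) < electionProb Q S st₀.pows C₀ e i := by
  obtain ⟨E, rfl, -, hslots⟩ := h
  refine elected_append_iff he hn hW (hA.pows_lt C₀ hA.mem_chains) fun B hB => ?_
  exact (mem_hitSlots.mp (hslots ▸ List.mem_map_of_mem hB)).1.1

lemma IsPrivate.elected_iff {W : List (PowBlock P)} {C : Chain P} {i : P} {r : ℕ} (he : 1 ≤ e)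
    (hn : n < Q.R) (hA : Agreement S ((e - 1) * Q.R) st₀ C₀) (hW : st₀.pows <+: W)
    (h : IsPrivate S ((e - 1) * Q.R) r C₀ C) :
    Elected Q S x W C ((e - 1) * Q.R + n + 1) i ↔
      (x ((e - 1) * Q.R + n + 1, i, false) : ℝ) < electionProb Q S st₀.pows C₀ e i := by
  obtain ⟨E, rfl, hE⟩ := h
  exact elected_append_iff he hn hW (hA.pows_lt C₀ hA.mem_chains) fun B hB => (hE B hB).2.1

lemma publicInvariant_run (he : 1 ≤ e) (hN : N ≤ Q.R) (hA : Agreement S ((e - 1) * Q.R) st₀ C₀)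
    (hk : (electionSlots Q S st₀ C₀ e x true N).length ≤ Q.k) (hn : n ≤ N) :
    PublicInvariant S C₀ (electionSlots Q S st₀ C₀ e x true n)
      (run Q S (privateAttack S ((e - 1) * Q.R) N C₀) ((e - 1) * Q.R) st₀ x n) := by
  induction n with
  | zero => exact publicInvariant_of_agreement hA
  | succ n ih =>
    have inv := ih (by omega)
    set st := run Q S (privateAttack S ((e - 1) * Q.R) N C₀) ((e - 1) * Q.R) st₀ x n
    have hk' : (electionSlots Q S st₀ C₀ e x true n).length ≤ Q.k :=
      (hitSlots_prefix (by omega)).length_le.trans hk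
    set a := privateAttack S ((e - 1) * Q.R) N C₀ ((e - 1) * Q.R + n + 1) st
    have no_delivery (i : P) : a.deliver i = ∅ := privateAttack_deliver_of_ne (by omega) st i
    have elected_iff (i : P) (hi : i ∉ S.corrupt) :
        Elected Q S x st.pows (adopt Q st a i) ((e - 1) * Q.R + n + 1) i ↔
          (x ((e - 1) * Q.R + n + 1, i, false) : ℝ) < electionProb Q S st₀.pows C₀ e i :=
      (inv.isHonestExtension_adopt hk' (no_delivery i) hi).elected_iff he (by omega) hA
        pows_prefix_pows_run
    by_cases hhit : Hit (electionProb Q S st₀.pows C₀ e) (S.side true) x ((e - 1) * Q.R + n + 1)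
    · rw [electionSlots, hitSlots_succ_of_hit hhit]
      obtain ⟨i, hi, hlt⟩ := hhit
      have hi := Setup.mem_side_true.mp hi
      exact inv.step_of_elected hk' no_delivery hi ((elected_iff i hi).mpr hlt)
    · rw [electionSlots, hitSlots_succ_of_not_hit hhit]
      exact inv.step_of_not_elected hk' no_delivery fun i hi hel =>
        hhit ⟨i, Setup.mem_side_true.mpr hi, (elected_iff i hi).mp hel⟩

lemma exists_isPrivate_mem_chains_run (he : 1 ≤ e) (hA : Agreement S ((e - 1) * Q.R) st₀ C₀)
    (hn : n ≤ Q.R) {l : ℕ} (hl : l ≤ (electionSlots Q S st₀ C₀ e x false n).length) :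
    ∃ C ∈ (run Q S (privateAttack S ((e - 1) * Q.R) N C₀) ((e - 1) * Q.R) st₀ x n).chains,
      IsPrivate S ((e - 1) * Q.R) ((e - 1) * Q.R + n + 1) C₀ C ∧ C.length = C₀.length + l := by
  induction n generalizing l with
  | zero =>
    obtain rfl : l = 0 := Nat.le_zero.mp hl
    exact ⟨C₀, hA.mem_chains, .refl _ _ _ _, rfl⟩
  | succ n ih =>
    by_cases hold : l ≤ (electionSlots Q S st₀ C₀ e x false n).length
    · obtain ⟨C, hC, hprivate, hlength⟩ := ih (by omega) hold
      exact ⟨C, chains_subset_chains_step hC, hprivate.mono (by omega), hlength⟩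
    by_cases hhit : Hit (electionProb Q S st₀.pows C₀ e) (S.side false) x ((e - 1) * Q.R + n + 1)
    · obtain ⟨C, hC, hprivate, hlength⟩ := ih (by omega) le_rfl
      rw [electionSlots, hitSlots_succ_of_hit hhit, List.length_append, List.length_singleton]
        at hl
      obtain ⟨i, hi, hlt⟩ := hhit
      refine ⟨_, hprivate.append_block_mem_chains_step (by omega)
        (hA.slots_le C₀ hA.mem_chains) hC hi
        ((hprivate.elected_iff he (by omega) hA pows_prefix_pows_run).mpr hlt),
        hprivate.append_block (by omega) hi rfl, ?_⟩
      rw [electionSlots] at hold hlength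
      rw [List.length_append, hlength, List.length_singleton]
      omega
    · rw [electionSlots, hitSlots_succ_of_not_hit hhit] at hl
      exact absurd hl hold

lemma not_prune_prefix_of_isPrivate {C₁ C₂ : Chain P} {H H' : List ℕ} {ℓ r t r' : ℕ}
    (h₁ : IsHonestExtension S C₀ H C₁) (h₂ : IsPrivate S t r' C₀ C₂) (hH' : H' <+: H)
    (hne : H' ≠ []) (hslots : ∀ u ∈ H', u + ℓ ≤ r) (hC₀ : ∀ B ∈ C₀, B.slot + ℓ ≤ r) :
    ¬ prune ℓ r C₁ <+: C₂ := by
  intro hprefix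
  obtain ⟨H'', rfl⟩ := hH'
  obtain ⟨E₁, rfl, honest, hmap⟩ := h₁
  obtain ⟨E₂, rfl, hcorrupt⟩ := h₂
  obtain ⟨E', E'', rfl, rfl, -⟩ := List.map_eq_append_iff.mp hmap
  have hsurvive : C₀ ++ E' <+: prune ℓ r (C₀ ++ (E' ++ E'')) := by
    refine prefix_prune (by simp) fun B hB => ?_
    exact (List.mem_append.mp hB).elim (hC₀ B) fun hB => hslots _ (List.mem_map_of_mem hB)
  have hcommon : E' <+: E₂ := (List.prefix_append_right_inj C₀).mp (hsurvive.trans hprefix)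
  obtain ⟨B, hB⟩ := List.exists_mem_of_ne_nil E' (by simpa using hne)
  exact honest B (List.mem_append_left _ hB) (hcorrupt B (hcommon.subset hB)).1

lemma not_commonPrefix_of_attackPattern {ℓ s : ℕ} (he : 1 ≤ e) (hN : ℓ + s < Q.R)
    (hℓk : ℓ ≤ Q.k) (hA : Agreement S ((e - 1) * Q.R) st₀ C₀)
    (hx : hitPattern (electionProb Q S st₀.pows C₀ e) S.side ((e - 1) * Q.R) (ℓ + s) x ∈
      attackPatterns (ℓ + s) s ℓ) :
    ¬ CommonPrefix Q S (privateAttack S ((e - 1) * Q.R) (ℓ + s) C₀) ((e - 1) * Q.R) st₀ x ℓ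
      Q.R := by
  simp only [attackPatterns, Set.mem_ofPred_eq, ← length_hitSlots] at hx
  obtain ⟨hle, ⟨m, hms, hm⟩, hfew⟩ := hx
  have hhit : Hit (electionProb Q S st₀.pows C₀ e) (S.side true) x ((e - 1) * Q.R + m + 1) := by
    simpa [hitPattern] using hm
  obtain ⟨i, hi, -⟩ := id hhit
  have hi := Setup.mem_side_true.mp hi
  set A := privateAttack S ((e - 1) * Q.R) (ℓ + s) C₀
  set st := run Q S A ((e - 1) * Q.R) st₀ x (ℓ + s)
  set a := A ((e - 1) * Q.R + (ℓ + s) + 1) st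
  have inv : PublicInvariant S C₀ (electionSlots Q S st₀ C₀ e x true (ℓ + s)) st :=
    publicInvariant_run he hN.le hA (hfew.trans hℓk) le_rfl
  obtain ⟨C₁, hC₁, honest⟩ := inv.exists_extension
  obtain ⟨C₂, hC₂, hprivate, hlength⟩ :=
    exists_isPrivate_mem_chains_run (N := ℓ + s) he hA hN.le hle
  have hview₁ : C₁ ∈ view st a i := .inl hC₁
  have hview₂ : C₂ ∈ view st a i :=
    .inr ⟨⟨rfl, hprivate, C₁, hC₁, (hlength.trans honest.length_eq.symm).le⟩, hC₂⟩
  have held_of_mem_view {C : Chain P} :=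
    inv.mem_held (Q := Q) (a := a) (C := C) (hfew.trans hℓk) hi fun _ =>
      inv.length_le_of_mem_view_privateAttack
  have held₁ := held_of_mem_view hview₁ honest.isPrefix honest.length_eq
  have held₂ := held_of_mem_view hview₂ hprivate.isPrefix hlength
  intro hCP
  refine not_prune_prefix_of_isPrivate honest hprivate
    (hitSlots_prefix (Nat.succ_le_of_lt m.2)) ?_ (fun u hu => ?_) (fun B hB => ?_)
    (hCP (ℓ + s) (ℓ + s) le_rfl hN i i C₁ C₂ ⟨hi, held₁⟩ ⟨hi, held₂⟩)
  · exact List.ne_nil_of_mem (mem_hitSlots.mpr ⟨⟨by omega, le_rfl⟩, hhit⟩)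
  · have := (mem_hitSlots.mp hu).1.2
    omega
  · have := hA.slots_le C₀ hA.mem_chains B hB
    omega

lemma sum_side_virtualStake (W : List (PowBlock P)) (C : Chain P) (b : Bool) :
    ∑ i ∈ S.side b, virtualStake Q S W C e i =
      if b then 1 - advVirtualStake Q S W C e else advVirtualStake Q S W C e := by
  classical
  cases b
  · rfl
  · rw [if_pos rfl, advVirtualStake, ← sum_virtualStake Q S W C e,
      ← sum_compl_add_sum S.corrupt (virtualStake Q S W C e), add_sub_cancel_right]
    exact sum_congr (by ext; simp [Setup.mem_side_true]) fun _ _ => rfl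

lemma le_cpFailure_privateAttack {ℓ s : ℕ} (he : 1 ≤ e) (hN : ℓ + s < Q.R) (hℓk : ℓ ≤ Q.k)
    (hA : Agreement S ((e - 1) * Q.R) st₀ C₀) :
    (Measure.pi fun p => (coinLaw P).map fun x =>
        hitPattern (electionProb Q S st₀.pows C₀ e) S.side ((e - 1) * Q.R) (ℓ + s) x p)
      (attackPatterns (ℓ + s) s ℓ) ≤
      cpFailure Q S (privateAttack S ((e - 1) * Q.R) (ℓ + s) C₀) ((e - 1) * Q.R) st₀ ℓ Q.R := by
  rw [← map_hitPattern_coinLaw _ S.disjoint_side, Measure.map_apply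
    (measurable_pi_lambda _ (measurable_hitPattern_apply _ S.side _)) .of_discrete]
  exact measure_mono fun x hx => not_commonPrefix_of_attackPattern he hN hℓk hA hx

theorem exists_adversary_le_cpFailure {f : ℝ} (hf0 : 0 < f) (hf1 : f < 1) :
    ∃ ℓ₀ : ℕ, 16 ≤ ℓ₀ ∧ ∀ (Q : Params) (ℓ : ℕ), Q.f = f → ℓ₀ ≤ ℓ → ℓ ≤ Q.k → 2 * ℓ ≤ Q.R →
      ∀ (P : Type) [Fintype P] (S : Setup P) (e : ℕ) (st : State P) (C₀ : Chain P), 1 ≤ e →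
        Agreement S ((e - 1) * Q.R) st C₀ →
        |advVirtualStake Q S st.pows C₀ e - 1 / 2| ≤ 1 / √ℓ →
        ∃ A : Adversary P, ENNReal.ofReal (Real.exp (-128) / 16) ≤
          cpFailure Q S A ((e - 1) * Q.R) st ℓ Q.R := by
  obtain ⟨ℓ₀, s, h16, hs, hbound⟩ := exists_attackPatterns_bound (sub_pos.mpr hf1)
    (sub_lt_self 1 hf0)
  refine ⟨ℓ₀, h16, fun Q ℓ hQ hℓ hk hR P _ S e st C₀ he hA hα =>
    ⟨_, le_trans ?_ (le_cpFailure_privateAttack (s := s) he (by omega) hk hA)⟩⟩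
  have hprob (p : Fin (ℓ + s) × Bool) : IsProbabilityMeasure ((coinLaw P).map fun x =>
      hitPattern (electionProb Q S st.pows C₀ e) S.side ((e - 1) * Q.R) (ℓ + s) x p) :=
    Measure.isProbabilityMeasure_map (measurable_hitPattern_apply _ S.side _ p).aemeasurable
  refine ENNReal.ofReal_le_of_le_toReal <| hbound ℓ hℓ
    (fun b => ∑ i ∈ S.side b, virtualStake Q S st.pows C₀ e i) (fun b => ?_) _ fun p => ?_
  · rw [sum_side_virtualStake]
    cases b
    · exact hα
    · rw [if_pos rfl, ← abs_neg]
      convert hα using 2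
      ring
  · rw [map_hitPattern_apply_real_false (electionProb_nonneg Q S hA.target_pos C₀ e)
      (electionProb_le_one Q S st.pows C₀ e), prod_one_sub_electionProb, hQ]

end Attack

section FirstEpoch

/-- One honest and one corrupted party with stake `1 / 2 + δ` and `1 / 2 - δ`; the honest party is
the only miner. -/
noncomputable def twoPartySetup (δ : ℝ) (h0 : 0 ≤ δ) (h1 : δ ≤ 1 / 2) : Setup (Fin 2) where
  corrupt := {1}
  stake i := if i = 1 then 1 / 2 - δ else 1 / 2 + δ
  stake_nonneg i := by split_ifs <;> linarith
  stake_pos := by simp [Fin.sum_univ_two]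
  honestMiners _ := {0}
  corruptMiners _ := ∅
  honestMiners_honest _ := by simp
  corruptMiners_corrupt _ := by simp
  miners_pos _ := by simp
  hEst := 1
  hEst_pos := one_pos

variable {δ : ℝ} {h0 : 0 ≤ δ} {h1 : δ ≤ 1 / 2}

lemma twoPartySetup_sum_stake : ∑ i, (twoPartySetup δ h0 h1).stake i = 1 := by
  rw [Fin.sum_univ_two]
  change 1 / 2 + δ + (1 / 2 - δ) = 1
  ring

lemma twoPartySetup_betaS : (twoPartySetup δ h0 h1).betaS = 1 / 2 - δ := by
  rw [Setup.betaS, twoPartySetup_sum_stake, div_one]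
  exact sum_singleton _ _

lemma twoPartySetup_h (r : ℕ) : (twoPartySetup δ h0 h1).h r = 1 := by
  simp [twoPartySetup, Setup.h]

lemma twoPartySetup_n (r : ℕ) : (twoPartySetup δ h0 h1).n r = 1 := by
  simp [twoPartySetup, Setup.n]

lemma twoPartySetup_betaW {a b : ℕ} (hab : a ≤ b) : (twoPartySetup δ h0 h1).betaW a b hab = 0 := by
  simp [Setup.betaW, twoPartySetup_h, twoPartySetup_n]

lemma twoPartySetup_bounded {ω : ℝ} (hω : 0 ≤ ω) (m : ℕ) :
    (twoPartySetup δ h0 h1).Bounded (1 / 2 - δ) m ω := by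
  intro a b hab _ _
  rw [twoPartySetup_betaW, twoPartySetup_betaS]
  nlinarith

lemma twoPartySetup_standing (R : ℕ) {γ α₀ ε : ℝ} (hγ : 1 ≤ γ) (hα0 : 0 < α₀) (hα1 : α₀ ≤ 1)
    (hε0 : 0 < ε) (hε1 : ε < 1) : (twoPartySetup δ h0 h1).Standing R δ γ α₀ ε where
  init_stake := twoPartySetup_betaS.le
  init_work_lower := by
    rw [twoPartySetup_h]
    exact div_le_one_of_le₀ (by nlinarith) (by positivity)
  init_work_upper := by
    rw [twoPartySetup_h, mul_one]
    exact (one_le_div (mul_pos (sub_pos.mpr hε1) hα0)).mpr (by nlinarith)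
  respecting_h r r' _ _ _ _ := by simpa [twoPartySetup_h] using hγ
  respecting_n r r' _ _ _ _ := by simpa [twoPartySetup_n] using hγ
  participation r _ := by simpa [twoPartySetup_h, twoPartySetup_n] using hα1

lemma agreement_genesis {P : Type} [Fintype P] (S : Setup P) : Agreement S 0 (genesis P) [] where
  cur_eq _ _ := rfl
  chains_finite := Set.finite_singleton _
  mem_chains := rfl
  mem_pub := rfl
  pub_chains := le_rfl
  pub_shorter _ hC hne := absurd hC hne
  slots_sorted := by simp [genesis]
  slots_pos := by simp [genesis]
  slots_le := by simp [genesis]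
  pows_lt := by simp [genesis]
  target_pos := by simp [genesis]

lemma advVirtualStake_epoch_one {P : Type} [Fintype P] (Q : Params) (S : Setup P)
    (W : List (PowBlock P)) (C : Chain P) : advVirtualStake Q S W C 1 = S.betaS := by
  simp [advVirtualStake, virtualStake, stakeShare, Setup.betaS, sum_div]

end FirstEpoch

end Minotaur

theorem mainTheorem7 :
    ∃ c : ℝ, 0 < c ∧ ∀ f : ℝ, 0 < f → f < 1 → ∃ ℓ₀ : ℕ,
      ∀ (Q : Minotaur.Params) (ℓ : ℕ) (δ : ℝ), Q.f = f → ℓ₀ ≤ ℓ → ℓ ≤ Q.k → 2 * ℓ ≤ Q.R →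
        0 ≤ δ → δ ≤ 1 / Real.sqrt ℓ →
        -- some adversary within the bounds breaks common prefix within the first epoch
        (∀ (m : ℕ) (γ α₀ ε : ℝ), 1 ≤ γ → 0 < α₀ → α₀ ≤ 1 → 0 < ε → ε < 1 →
          ∃ (n : ℕ) (S : Minotaur.Setup (Fin n)) (A : Minotaur.Adversary (Fin n)),
            S.Bounded (1 / 2 - δ) m Q.ω ∧ S.Standing Q.R δ γ α₀ ε ∧
            ENNReal.ofReal c ≤
              Minotaur.cpFailure Q S A 0 (Minotaur.genesis (Fin n)) ℓ Q.R) ∧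
        -- the attack can start in every epoch in which the adversary has enough virtual stake
        (∀ (P : Type) [Fintype P] (S : Minotaur.Setup P) (e : ℕ) (st : Minotaur.State P)
            (C₀ : Minotaur.Chain P), 1 ≤ e →
          Minotaur.Agreement S ((e - 1) * Q.R) st C₀ →
          1 / 2 - δ ≤ Minotaur.advVirtualStake Q S st.pows C₀ e →
          Minotaur.advVirtualStake Q S st.pows C₀ e ≤ 1 / 2 →
          ∃ A : Minotaur.Adversary P,
            ENNReal.ofReal c ≤ Minotaur.cpFailure Q S A ((e - 1) * Q.R) st ℓ Q.R) := by
  refine ⟨Real.exp (-128) / 16, by positivity, fun f hf0 hf1 => ?_⟩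
  obtain ⟨ℓ₀, h16, hattack⟩ := Minotaur.exists_adversary_le_cpFailure hf0 hf1
  refine ⟨ℓ₀, fun Q ℓ δ hQ hℓ hk hR hδ0 hδ => ⟨fun m γ α₀ ε hγ hα0 hα1 hε0 hε1 => ?_,
    fun P _ S e st C₀ he hA hlow hhigh => hattack Q ℓ hQ hℓ hk hR P S e st C₀ he hA <|
      abs_le.mpr ⟨by linarith, by linarith [hδ0.trans hδ]⟩⟩⟩
  have hδ_le_half : δ ≤ 1 / 2 := by
    have h4 : (4 : ℝ) ≤ ℓ := by exact_mod_cast (by omega : 4 ≤ ℓ)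
    exact hδ.trans (one_div_le_one_div_of_le two_pos (Real.le_sqrt_of_sq_le (by linarith)))
  let S := Minotaur.twoPartySetup δ hδ0 hδ_le_half
  have hα : |Minotaur.advVirtualStake Q S [] [] 1 - 1 / 2| ≤ 1 / √ℓ := by
    rwa [Minotaur.advVirtualStake_epoch_one, Minotaur.twoPartySetup_betaS, sub_sub_cancel_left,
      abs_neg, abs_of_nonneg hδ0]
  obtain ⟨A, hA⟩ := hattack Q ℓ hQ hℓ hk hR (Fin 2) S 1 (Minotaur.genesis _) [] le_rfl
    (by simpa using Minotaur.agreement_genesis S) hα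
  exact ⟨2, S, A, Minotaur.twoPartySetup_bounded Q.ω_nonneg m,
    Minotaur.twoPartySetup_standing Q.R hγ hα0 hα1 hε0 hε1, by simpa using hA⟩
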